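/- Let $\mathcal V$ be a locally presentable braided monoidal closed category with braiding $c$; $[X,-]$ denotes the right adjoint of $-\otimes X$, and an object is called dualizable if it has a (left) dual. Let $A$ and $B$ be monoids in $\mathcal V$, with multiplications and units written $\mu,\eta$. (Associativity and unit isomorphisms are suppressed.) Notation. $\mathcal V_B$ and $\mathcal V^B$ are the Kleisli and Eilenberg–Moore categories of the monad $-\otimes B$. The monad $A\otimes-$ on $\mathcal V$ extends to $\mathcal V_B$ and lifts to $\mathcal V^B$. $\mathcal V_B(X,X)=[X,X\otimes B]$ is a monoid under Kleisli composition, and $\mathcal V^B(M,M)$, the equalizer of the canonical pair $[M,M]\rightrightarrows[M\otimes B,M]$, is a monoid under composition. For a comonoid $C$, $[C,B]$ is the convolution monoid. $P(A,B)$ is the universal measuring comonoid, i.e. a comonoid equipped with bijections $\mathrm{Comon}(\mathcal V)(C,P(A,B))\cong\mathrm{Mon}(\mathcal V)(A,[C,B])$ natural in the comonoid $C$; $e\colon A\otimes P(A,B)\to B$ is the universal measuring, the transpose of the monoid morphism $A\to[P(A,B),B]$ that corresponds to the identity of $P(A,B)$. The category ${}^A\mathcal V_B$ has as objects the pairs $(X,\psi)$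 with $\psi\colon A\otimes X\to X\otimes B$ satisfying $$\psi(\mu\otimes X)=(X\otimes\mu)(\psi\otimes B)(A\otimes\psi),\qquad \psi(\eta\otimes X)=X\otimes\eta ,\qquad(*)$$ and as morphisms $(X,\psi)\to(X',\psi')$ the morphisms $f\colon X\to X'$ of $\mathcal V$ with $(f\otimes B)\psi=\psi'(A\otimes f)$. (1) For every object $X$ there are bijections between (a) morphisms $\psi\colon A\otimes X\to X\otimes B$ satisfying $(*)$; (b) algebra structures on $X$ for the monad $A\otimes-$ on $\mathcal V_B$; (c) monoid morphisms $A\to\mathcal V_B(X,X)=[X,X\otimes B]$; (d) algebra structures on the free algebra $X\otimes B$ for the monad $A\otimes-$ on $\mathcal V^B$; (e) monoid morphisms $A\to\mathcal V^B(X\otimes B,X\otimes B)$. Here (a) and (b) have the same underlying morphism $\psi$ of $\mathcal V$; (b)–(c) and (d)–(e) are given by transposition; (b)–(d) sends $\psi$ to $(X\otimes\mu)(\psi\otimes B)$; (c)–(e) is composition with the comparison $[X,X\otimes B]\to\mathcal V^B(X\otimes B,X\otimes B)$; and these bijections are compatible: the composites from (b) to (e) through (c) and through (d) agree. (2) For every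 dualizable $X$, these data are moreover in bijection with the right $P(A,B)$-comodule structures $\rho\colon X\to X\otimes P(A,B)$ on $X$; the morphism $\psi$ of (a) that corresponds to $\rho$ is $$A\otimes X\xrightarrow{A\otimes\rho}A\otimes X\otimes P(A,B)\xrightarrow{c_{X,A}^{-1}\otimes P(A,B)}X\otimes A\otimes P(A,B)\xrightarrow{X\otimes e}X\otimes B .$$ (3) There is an isomorphism of categories between the category of dualizable right $P(A,B)$-comodules and the category of dualizable objects of ${}^A\mathcal V_B$ (those $(X,\psi)$ with $X$ dualizable in $\mathcal V$). It commutes with the forgetful functors into $\mathcal V$ and is given on objects by the bijections of (2). -/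

import Mathlib

open CategoryTheory MonoidalCategory Opposite Limits

universe w v u

noncomputable section

namespace Sweedler

variable {V : Type u} [Category.{v} V] [MonoidalCategory V]

/-! ### Duals -/

/-- `X` is dualizable: there are an object `Y` and morphisms `Y ⊗ X ⟶ 𝟙_ V`, `𝟙_ V ⟶ X ⊗ Y`
satisfying the two triangular equalities. -/
def IsDualizable (X : V) : Prop := ∃ Y : V, Nonempty (ExactPairing X Y)

/-! ### The monads `- ⊗ B` on `V`, and `A ⊗ -` on its Kleisli and Eilenberg-Moore categories -/

/-- The monad `- ⊗ B` on `V`. -/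
@[simps! obj map η_app μ_app]
def tensorRightMonad (B : Mon V) : Monad V where
  toFunctor := tensorRight B.X
  η := { app := fun X => (ρ_ X).inv ≫ X ◁ B.mon.one
         naturality := fun X Y f => by
           dsimp
           rw [rightUnitor_inv_naturality_assoc, ← whisker_exchange, Category.assoc] }
  μ := { app := fun X => (α_ X B.X B.X).hom ≫ X ◁ B.mon.mul
         naturality := fun X Y f => by
           simp [whisker_exchange] }
  left_unit X := by
    simp [← MonoidalCategory.whiskerLeft_comp]
  right_unit X := by
    simp [← MonoidalCategory.whiskerLeft_comp]
  assoc X := by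
    have h := congrArg (X ◁ ·) (MonObj.mul_assoc B.X)
    simp only [MonoidalCategory.whiskerLeft_comp] at h
    simp [h]

/-- The Kleisli category `V_B` of the monad `- ⊗ B`. -/
abbrev KleisliCat (B : Mon V) := Kleisli (tensorRightMonad B)

/-- The category `V^B` of Eilenberg-Moore algebras for the monad `- ⊗ B`. -/
abbrev EMCat (B : Mon V) := (tensorRightMonad B).Algebra

section KleisliLemmas

variable (A B : Mon V) {W X Y Z : V}

lemma kl_pure_comp (h : X ⟶ Y) (g : Y ⟶ Z ⊗ B.X) :
    (h ≫ (ρ_ Y).inv ≫ Y ◁ B.mon.one) ≫ g ▷ B.X ≫ (α_ Z B.X B.X).hom ≫ Z ◁ B.mon.mul = h ≫ g := by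
  simp [whisker_exchange_assoc, ← MonoidalCategory.whiskerLeft_comp]

lemma kl_comp_pure (f : X ⟶ Y ⊗ B.X) (h : Y ⟶ Z) :
    f ≫ (h ≫ (ρ_ Z).inv ≫ Z ◁ B.mon.one) ▷ B.X ≫ (α_ Z B.X B.X).hom ≫ Z ◁ B.mon.mul =
      f ≫ h ▷ B.X := by
  simp [← MonoidalCategory.whiskerLeft_comp]

lemma kl_map_pure (h : X ⟶ Y) :
    A.X ◁ (h ≫ (ρ_ Y).inv ≫ Y ◁ B.mon.one) ≫ (α_ A.X Y B.X).inv =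
      A.X ◁ h ≫ (ρ_ (A.X ⊗ Y)).inv ≫ (A.X ⊗ Y) ◁ B.mon.one := by
  simp

lemma kl_map_comp (f : X ⟶ Y ⊗ B.X) (g : Y ⟶ Z ⊗ B.X) :
    A.X ◁ (f ≫ g ▷ B.X ≫ (α_ Z B.X B.X).hom ≫ Z ◁ B.mon.mul) ≫ (α_ A.X Z B.X).inv =
      (A.X ◁ f ≫ (α_ A.X Y B.X).inv) ≫ (A.X ◁ g ≫ (α_ A.X Z B.X).inv) ▷ B.X ≫
        (α_ (A.X ⊗ Z) B.X B.X).hom ≫ (A.X ⊗ Z) ◁ B.mon.mul := by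
  simp

lemma unit_nat (f : X ⟶ Y) :
    f ≫ (λ_ Y).inv ≫ A.mon.one ▷ Y = ((λ_ X).inv ≫ A.mon.one ▷ X) ≫ A.X ◁ f := by
  simp [← whisker_exchange]

lemma mul_nat (f : X ⟶ Y) :
    A.X ◁ A.X ◁ f ≫ (α_ A.X A.X Y).inv ≫ A.mon.mul ▷ Y =
      ((α_ A.X A.X X).inv ≫ A.mon.mul ▷ X) ≫ A.X ◁ f := by
  simp [← whisker_exchange]

lemma act_left_unit (X : V) :
    ((λ_ (A.X ⊗ X)).inv ≫ A.mon.one ▷ (A.X ⊗ X)) ≫ (α_ A.X A.X X).inv ≫ A.mon.mul ▷ X = 𝟙 _ := by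
  simp [← comp_whiskerRight]

lemma act_right_unit (X : V) :
    A.X ◁ ((λ_ X).inv ≫ A.mon.one ▷ X) ≫ (α_ A.X A.X X).inv ≫ A.mon.mul ▷ X = 𝟙 _ := by
  have h := congrArg (· ▷ X) (MonObj.mul_one A.X)
  rw [comp_whiskerRight, whisker_assoc, ← triangle, Category.assoc, Category.assoc,
    cancel_epi] at h
  rw [MonoidalCategory.whiskerLeft_comp, Category.assoc, h]
  simp

lemma act_assoc (X : V) :
    A.X ◁ ((α_ A.X A.X X).inv ≫ A.mon.mul ▷ X) ≫ (α_ A.X A.X X).inv ≫ A.mon.mul ▷ X =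
      ((α_ A.X A.X (A.X ⊗ X)).inv ≫ A.mon.mul ▷ (A.X ⊗ X)) ≫
        (α_ A.X A.X X).inv ≫ A.mon.mul ▷ X := by
  have h := congrArg (· ▷ X) (MonObj.mul_assoc A.X)
  simp only [comp_whiskerRight] at h
  simp [h]

lemma unit_tensor (X Z : V) :
    (λ_ (X ⊗ Z)).inv ≫ A.mon.one ▷ (X ⊗ Z) =
      ((λ_ X).inv ≫ A.mon.one ▷ X) ▷ Z ≫ (α_ A.X X Z).hom := by
  simp

lemma mul_tensor (X Z : V) :
    (α_ A.X A.X (X ⊗ Z)).inv ≫ A.mon.mul ▷ (X ⊗ Z) =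
      (A.X ◁ (α_ A.X X Z).inv ≫ (α_ A.X (A.X ⊗ X) Z).inv) ≫
      ((α_ A.X A.X X).inv ≫ A.mon.mul ▷ X) ▷ Z ≫ (α_ A.X X Z).hom := by
  simp

lemma kl_unit_nat (f : X ⟶ Y ⊗ B.X) :
    f ≫ ((λ_ Y).inv ≫ A.mon.one ▷ Y) ▷ B.X =
      ((λ_ X).inv ≫ A.mon.one ▷ X) ≫ A.X ◁ f ≫ (α_ A.X Y B.X).inv := by
  have h := unit_nat A f
  rw [unit_tensor] at h
  rw [← Category.assoc _ (A.X ◁ f), ← h]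
  simp

lemma kl_mul_nat (f : X ⟶ Y ⊗ B.X) :
    (A.X ◁ (A.X ◁ f ≫ (α_ A.X Y B.X).inv) ≫ (α_ A.X (A.X ⊗ Y) B.X).inv) ≫
        ((α_ A.X A.X Y).inv ≫ A.mon.mul ▷ Y) ▷ B.X =
      ((α_ A.X A.X X).inv ≫ A.mon.mul ▷ X) ≫ A.X ◁ f ≫ (α_ A.X Y B.X).inv := by
  have h := mul_nat A f
  rw [mul_tensor] at h
  rw [← Category.assoc _ (A.X ◁ f), ← h]
  simp

lemma em_unit {M : V} (a : M ⊗ B.X ⟶ M) (h : ((ρ_ M).inv ≫ M ◁ B.mon.one) ≫ a = 𝟙 _) :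
    ((ρ_ (A.X ⊗ M)).inv ≫ (A.X ⊗ M) ◁ B.mon.one) ≫ (α_ A.X M B.X).hom ≫ A.X ◁ a = 𝟙 _ := by
  have h' := congrArg (A.X ◁ ·) h
  simp only [MonoidalCategory.whiskerLeft_comp, MonoidalCategory.whiskerLeft_id,
    Category.assoc] at h'
  simpa using h'

lemma em_assoc {M : V} (a : M ⊗ B.X ⟶ M)
    (h : ((α_ M B.X B.X).hom ≫ M ◁ B.mon.mul) ≫ a = a ▷ B.X ≫ a) :
    ((α_ (A.X ⊗ M) B.X B.X).hom ≫ (A.X ⊗ M) ◁ B.mon.mul) ≫ (α_ A.X M B.X).hom ≫ A.X ◁ a =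
      ((α_ A.X M B.X).hom ≫ A.X ◁ a) ▷ B.X ≫ (α_ A.X M B.X).hom ≫ A.X ◁ a := by
  have h' := congrArg (A.X ◁ ·) h
  simp only [MonoidalCategory.whiskerLeft_comp, Category.assoc] at h'
  simp [← h']

lemma em_map {M N : V} (a : M ⊗ B.X ⟶ M) (b : N ⊗ B.X ⟶ N) (f : M ⟶ N)
    (h : f ▷ B.X ≫ b = a ≫ f) :
    (A.X ◁ f) ▷ B.X ≫ (α_ A.X N B.X).hom ≫ A.X ◁ b =
      ((α_ A.X M B.X).hom ≫ A.X ◁ a) ≫ A.X ◁ f := by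
  have h' := congrArg (A.X ◁ ·) h
  simp only [MonoidalCategory.whiskerLeft_comp] at h'
  simp [← h']

lemma em_one {M : V} (a : M ⊗ B.X ⟶ M) :
    ((λ_ M).inv ≫ A.mon.one ▷ M) ▷ B.X ≫ (α_ A.X M B.X).hom ≫ A.X ◁ a =
      a ≫ (λ_ M).inv ≫ A.mon.one ▷ M := by
  have h := unit_nat A a
  rw [unit_tensor] at h
  rw [← Category.assoc]
  exact h.symm

lemma em_mul {M : V} (a : M ⊗ B.X ⟶ M) :
    ((α_ A.X A.X M).inv ≫ A.mon.mul ▷ M) ▷ B.X ≫ (α_ A.X M B.X).hom ≫ A.X ◁ a =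
      ((α_ A.X (A.X ⊗ M) B.X).hom ≫ A.X ◁ ((α_ A.X M B.X).hom ≫ A.X ◁ a)) ≫
        (α_ A.X A.X M).inv ≫ A.mon.mul ▷ M := by
  have h := mul_nat A a
  rw [mul_tensor] at h
  simp only [MonoidalCategory.whiskerLeft_comp, Category.assoc]
  rw [h]
  simp

end KleisliLemmas

/-- The monad `A ⊗ -` on `V_B`. -/
def kleisliMonad (A B : Mon V) : Monad (KleisliCat B) where
  obj X := Kleisli.mk _ (A.X ⊗ X.of)
  map {X Y} f := ⟨A.X ◁ f.of ≫ (α_ A.X Y.of B.X).inv⟩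
  map_id X := Kleisli.hom_ext (by
    have h := kl_map_pure A B (𝟙 X.of)
    rw [Category.id_comp, MonoidalCategory.whiskerLeft_id, Category.id_comp] at h
    exact h)
  map_comp f g := Kleisli.hom_ext (kl_map_comp A B f.of g.of)
  η := { app := fun X => (Kleisli.Adjunction.toKleisli _).map ((λ_ X.of).inv ≫ A.mon.one ▷ X.of)
         naturality := fun X Y f => Kleisli.hom_ext
           ((kl_comp_pure B f.of _).trans ((kl_unit_nat A B f.of).trans
             (kl_pure_comp B _ _).symm)) }
  μ := { app := fun X => (Kleisli.Adjunction.toKleisli _).map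
            ((α_ A.X A.X X.of).inv ≫ A.mon.mul ▷ X.of)
         naturality := fun X Y f => Kleisli.hom_ext
           ((kl_comp_pure B _ _).trans ((kl_mul_nat A B f.of).trans
             (kl_pure_comp B _ _).symm)) }
  left_unit X := by
    refine ((Kleisli.Adjunction.toKleisli (tensorRightMonad B)).map_comp _ _).symm.trans ?_
    exact (congrArg _ (act_left_unit A X.of)).trans (CategoryTheory.Functor.map_id _ _)
  right_unit X := by
    have h : (⟨A.X ◁ (((λ_ X.of).inv ≫ A.mon.one ▷ X.of) ≫
        (ρ_ (A.X ⊗ X.of)).inv ≫ (A.X ⊗ X.of) ◁ B.mon.one) ≫ (α_ A.X (A.X ⊗ X.of) B.X).inv⟩ :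
        Kleisli.mk (tensorRightMonad B) (A.X ⊗ X.of) ⟶ Kleisli.mk _ (A.X ⊗ A.X ⊗ X.of)) =
        (Kleisli.Adjunction.toKleisli (tensorRightMonad B)).map
          (A.X ◁ ((λ_ X.of).inv ≫ A.mon.one ▷ X.of)) :=
      Kleisli.hom_ext (kl_map_pure A B _)
    refine (congrArg (· ≫ _) h).trans ?_
    refine ((Kleisli.Adjunction.toKleisli (tensorRightMonad B)).map_comp _ _).symm.trans ?_
    exact (congrArg _ (act_right_unit A X.of)).trans (CategoryTheory.Functor.map_id _ _)
  assoc X := by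
    have h : (⟨A.X ◁ (((α_ A.X A.X X.of).inv ≫ A.mon.mul ▷ X.of) ≫
        (ρ_ (A.X ⊗ X.of)).inv ≫ (A.X ⊗ X.of) ◁ B.mon.one) ≫ (α_ A.X (A.X ⊗ X.of) B.X).inv⟩ :
        Kleisli.mk (tensorRightMonad B) (A.X ⊗ A.X ⊗ A.X ⊗ X.of) ⟶
          Kleisli.mk _ (A.X ⊗ A.X ⊗ X.of)) =
        (Kleisli.Adjunction.toKleisli (tensorRightMonad B)).map
          (A.X ◁ ((α_ A.X A.X X.of).inv ≫ A.mon.mul ▷ X.of)) :=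
      Kleisli.hom_ext (kl_map_pure A B _)
    refine (congrArg (· ≫ _) h).trans ?_
    refine ((Kleisli.Adjunction.toKleisli (tensorRightMonad B)).map_comp _ _).symm.trans ?_
    exact (congrArg _ (act_assoc A X.of)).trans (CategoryTheory.Functor.map_comp _ _ _)

/-- The monad `A ⊗ -` on `V^B`. -/
def emMonad (A B : Mon V) : Monad (EMCat B) where
  obj M :=
    { A := A.X ⊗ M.A
      a := (α_ A.X M.A B.X).hom ≫ A.X ◁ M.a
      unit := em_unit A B M.a M.unit
      assoc := em_assoc A B M.a M.assoc }
  map {M N} f := { f := A.X ◁ f.f, h := em_map A B M.a N.a f.f f.h }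
  map_id _ := Monad.Algebra.Hom.ext (MonoidalCategory.whiskerLeft_id _ _)
  map_comp _ _ := Monad.Algebra.Hom.ext (MonoidalCategory.whiskerLeft_comp _ _ _)
  η := { app := fun M => { f := (λ_ M.A).inv ≫ A.mon.one ▷ M.A, h := em_one A B M.a }
         naturality := fun _ _ f => Monad.Algebra.Hom.ext (unit_nat A f.f) }
  μ := { app := fun M => { f := (α_ A.X A.X M.A).inv ≫ A.mon.mul ▷ M.A, h := em_mul A B M.a }
         naturality := fun _ _ f => Monad.Algebra.Hom.ext (mul_nat A f.f) }
  left_unit X := Monad.Algebra.Hom.ext (act_left_unit A X.A)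
  right_unit X := Monad.Algebra.Hom.ext (act_right_unit A X.A)
  assoc X := Monad.Algebra.Hom.ext (act_assoc A X.A)

/-- An algebra structure on the object `X` for the monad `T`. -/
@[ext]
structure AlgebraOn {C : Type*} [Category* C] (T : Monad C) (X : C) where
  /-- The action. -/
  a : T.obj X ⟶ X
  unit : T.η.app X ≫ a = 𝟙 X
  assoc : T.μ.app X ≫ a = T.map a ≫ a

/-- The free Eilenberg-Moore algebra `X ⊗ B`. -/
abbrev freeAlg (B : Mon V) (X : V) : EMCat B where
  A := X ⊗ B.X
  a := (α_ X B.X B.X).hom ≫ X ◁ B.mon.mul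
  unit := ((tensorRightMonad B).free.obj X).unit
  assoc := ((tensorRightMonad B).free.obj X).assoc

/-- The action `M ⊗ B ⟶ M` of an Eilenberg-Moore algebra for `- ⊗ B`. -/
abbrev emAct {B : Mon V} (M : EMCat B) : M.A ⊗ B.X ⟶ M.A := M.a

lemma emAct_emAct (B : Mon V) (N : EMCat B) : emAct N ▷ B.X ≫ emAct N =
    (α_ N.A B.X B.X).hom ≫ N.A ◁ B.mon.mul ≫ emAct N :=
  (N.assoc.symm.trans (Category.assoc _ _ _) :)

lemma emAct_one (B : Mon V) (N : EMCat B) : (ρ_ N.A).inv ≫ N.A ◁ B.mon.one ≫ emAct N = 𝟙 _ :=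
  ((Category.assoc _ _ _).symm.trans N.unit :)

section Interchange

variable [BraidedCategory V] {W X Y Z W' X' Y' Z' : V}

lemma tensorδ_natural (f : W ⟶ W') (g : X ⟶ X') (h : Y ⟶ Y') (k : Z ⟶ Z') :
    ((f ⊗ₘ h) ⊗ₘ (g ⊗ₘ k)) ≫ tensorδ W' X' Y' Z' =
      tensorδ W X Y Z ≫ ((f ⊗ₘ g) ⊗ₘ (h ⊗ₘ k)) := by
  have e := tensorμ_natural f g h k
  have e' := congrArg (fun t => tensorδ W X Y Z ≫ t ≫ tensorδ W' X' Y' Z') e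
  simpa using e'.symm

lemma tensorδ_assoc (X₁ X₂ Y₁ Y₂ Z₁ Z₂ : V) :
    tensorδ (X₁ ⊗ Y₁) (X₂ ⊗ Y₂) Z₁ Z₂ ≫ tensorδ X₁ X₂ Y₁ Y₂ ▷ (Z₁ ⊗ Z₂) ≫ (α_ _ _ _).hom =
      ((α_ X₁ Y₁ Z₁).hom ⊗ₘ (α_ X₂ Y₂ Z₂).hom) ≫ tensorδ X₁ X₂ (Y₁ ⊗ Z₁) (Y₂ ⊗ Z₂) ≫
        (X₁ ⊗ X₂) ◁ tensorδ Y₁ Y₂ Z₁ Z₂ :=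
  Functor.OplaxMonoidal.associativity (tensor V) (X₁, X₂) (Y₁, Y₂) (Z₁, Z₂)

lemma tensorδ_left (W X : V) :
    tensorδ (𝟙_ V) (𝟙_ V) W X ≫ (λ_ (𝟙_ V)).hom ▷ (W ⊗ X) ≫ (λ_ (W ⊗ X)).hom =
      ((λ_ W).hom ⊗ₘ (λ_ X).hom) :=
  Functor.OplaxMonoidal.left_unitality_hom (tensor V) (W, X)

lemma tensorδ_right (W X : V) :
    tensorδ W X (𝟙_ V) (𝟙_ V) ≫ (W ⊗ X) ◁ (λ_ (𝟙_ V)).hom ≫ (ρ_ (W ⊗ X)).hom =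
      ((ρ_ W).hom ⊗ₘ (ρ_ X).hom) :=
  Functor.OplaxMonoidal.right_unitality_hom (tensor V) (W, X)

lemma conv_assoc {H C B : V} (l : H ⊗ C ⟶ B) (d : C ⟶ C ⊗ C) (m : B ⊗ B ⟶ B)
    (hd : d ≫ C ◁ d = d ≫ d ▷ C ≫ (α_ C C C).hom) (hm : m ▷ B ≫ m = (α_ B B B).hom ≫ B ◁ m ≫ m) :
    ((H ⊗ H) ⊗ H) ◁ d ≫ tensorδ (H ⊗ H) C H C ≫
        ((H ⊗ H) ◁ d ≫ tensorδ H C H C ≫ (l ⊗ₘ l) ≫ m ⊗ₘ 𝟙 (H ⊗ C) ≫ l) ≫ m =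
      (α_ H H H).hom ▷ C ≫ (H ⊗ H ⊗ H) ◁ d ≫ tensorδ H C (H ⊗ H) C ≫
        (𝟙 (H ⊗ C) ≫ l ⊗ₘ (H ⊗ H) ◁ d ≫ tensorδ H C H C ≫ (l ⊗ₘ l) ≫ m) ≫ m := by
  have e3 := tensorδ_natural (𝟙 (H ⊗ H)) d (𝟙 H) (𝟙 C)
  have e4 := tensorδ_natural (𝟙 H) (𝟙 C) (𝟙 (H ⊗ H)) d
  rw [id_tensorHom_id, id_tensorHom_id, tensorHom_id, id_tensorHom, id_tensorHom,
    tensorHom_id] at e3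
  rw [id_tensorHom_id, id_tensorHom_id, id_tensorHom, id_tensorHom, id_tensorHom,
    id_tensorHom] at e4
  have h1 : (tensorδ H C H C ≫ (l ⊗ₘ l) ≫ m ⊗ₘ l) ≫ m =
      tensorδ H C H C ▷ (H ⊗ C) ≫ (α_ _ _ _).hom ≫ (l ⊗ₘ (l ⊗ₘ l)) ≫ B ◁ m ≫ m := by
    rw [← associator_naturality_assoc, ← hm, ← tensorHom_id, ← tensorHom_id,
      tensorHom_comp_tensorHom_assoc, tensorHom_comp_tensorHom_assoc]
    simp only [Category.id_comp, Category.comp_id, Category.assoc]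
  have h2 : (l ⊗ₘ tensorδ H C H C ≫ (l ⊗ₘ l) ≫ m) ≫ m =
      (H ⊗ C) ◁ tensorδ H C H C ≫ (l ⊗ₘ (l ⊗ₘ l)) ≫ B ◁ m ≫ m := by
    rw [← id_tensorHom, ← id_tensorHom,
      tensorHom_comp_tensorHom_assoc, tensorHom_comp_tensorHom_assoc]
    simp only [Category.id_comp, Category.comp_id, Category.assoc]
  rw [← tensorHom_comp_tensorHom_assoc, ← tensorHom_comp_tensorHom_assoc, h1, h2, tensorHom_id,
    id_tensorHom, ← reassoc_of% e3, ← reassoc_of% e4]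
  have h3 := tensorδ_assoc H C H C H C
  rw [reassoc_of% h3, MonoidalCategory.tensorHom_def, Category.assoc,
    ← whisker_exchange_assoc ((α_ H H H).hom), ← MonoidalCategory.whiskerLeft_comp_assoc,
    ← MonoidalCategory.whiskerLeft_comp_assoc, Category.assoc d, ← hd,
    MonoidalCategory.whiskerLeft_comp, Category.assoc, whisker_exchange_assoc,
    whisker_exchange_assoc]

end Interchange

/-! ### Internal homs -/

section Closed

variable [BraidedCategory V] [MonoidalClosed V]

/-- The left internal hom `[X, Y]`, characterised by the adjunction `- ⊗ X ⊣ [X, -]`. -/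
abbrev lhom (X Y : V) : V := (ihom X).obj Y

/-- The adjunction `- ⊗ X ⊣ [X, -]`. -/
def lhomAdj (X : V) : tensorRight X ⊣ ihom X :=
  (ihom.adjunction X).ofNatIsoLeft (BraidedCategory.tensorLeftIsoTensorRight X)

/-- The bijection between morphisms `Z ⊗ X ⟶ Y` and `Z ⟶ [X, Y]`. -/
def lcurry {Z X Y : V} : (Z ⊗ X ⟶ Y) ≃ (Z ⟶ lhom X Y) := (lhomAdj X).homEquiv Z Y

/-- Evaluation `[X, Y] ⊗ X ⟶ Y`. -/
def lev (X Y : V) : lhom X Y ⊗ X ⟶ Y := (lhomAdj X).counit.app Y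

lemma lcurry_symm_eq {Z X Y : V} (g : Z ⟶ lhom X Y) : lcurry.symm g = g ▷ X ≫ lev X Y :=
  (lhomAdj X).homEquiv_counit ..

@[simp]
lemma lcurry_lev {Z X Y : V} (f : Z ⊗ X ⟶ Y) : lcurry f ▷ X ≫ lev X Y = f := by
  rw [← lcurry_symm_eq, Equiv.symm_apply_apply]

lemma lhom_ext {Z X Y : V} {f g : Z ⟶ lhom X Y}
    (h : f ▷ X ≫ lev X Y = g ▷ X ≫ lev X Y) : f = g := by
  rw [← lcurry_symm_eq, ← lcurry_symm_eq] at h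
  exact lcurry.symm.injective h

@[simp]
lemma ihom_map_lev {X Y Z : V} (f : Y ⟶ Z) : (ihom X).map f ▷ X ≫ lev X Z = lev X Y ≫ f :=
  (lhomAdj X).counit.naturality f

/-- Precomposition `[X', Y] ⟶ [X, Y]` with `f : X ⟶ X'`. -/
def lpre {X X' : V} (f : X ⟶ X') (Y : V) : lhom X' Y ⟶ lhom X Y :=
  lcurry (lhom X' Y ◁ f ≫ lev X' Y)

/-- Composition `[Y, Z] ⊗ [X, Y] ⟶ [X, Z]`. -/
def lcomp (X Y Z : V) : lhom Y Z ⊗ lhom X Y ⟶ lhom X Z :=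
  lcurry ((α_ _ _ _).hom ≫ lhom Y Z ◁ lev X Y ≫ lev Y Z)

/-- The identity `𝟙_ V ⟶ [X, X]`. -/
def lid (X : V) : 𝟙_ V ⟶ lhom X X := lcurry (λ_ X).hom

/-- The action `[X, Y] ⟶ [X ⊗ B, Y ⊗ B]` on hom objects of the `V`-functor `- ⊗ B`. -/
def lwhisker (X Y B : V) : lhom X Y ⟶ lhom (X ⊗ B) (Y ⊗ B) :=
  lcurry ((α_ _ _ _).inv ≫ lev X Y ▷ B)

@[simp]
lemma lpre_lev {X X' : V} (f : X ⟶ X') (Y : V) :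
    lpre f Y ▷ X ≫ lev X Y = lhom X' Y ◁ f ≫ lev X' Y := lcurry_lev _

@[simp]
lemma lcomp_lev (X Y Z : V) :
    lcomp X Y Z ▷ X ≫ lev X Z = (α_ _ _ _).hom ≫ lhom Y Z ◁ lev X Y ≫ lev Y Z := lcurry_lev _

@[simp]
lemma lid_lev (X : V) : lid X ▷ X ≫ lev X X = (λ_ X).hom := lcurry_lev _

@[simp]
lemma lwhisker_lev (X Y B : V) :
    lwhisker X Y B ▷ (X ⊗ B) ≫ lev (X ⊗ B) (Y ⊗ B) = (α_ _ _ _).inv ≫ lev X Y ▷ B := lcurry_lev _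

lemma lid_lcomp (X Y : V) : lid Y ▷ lhom X Y ≫ lcomp X Y Y = (λ_ _).hom := by
  apply lhom_ext
  rw [comp_whiskerRight, Category.assoc, lcomp_lev, associator_naturality_left_assoc,
    ← whisker_exchange_assoc, lid_lev]
  simp

lemma lcomp_lid (X Y : V) : lhom X Y ◁ lid X ≫ lcomp X X Y = (ρ_ _).hom := by
  apply lhom_ext
  rw [comp_whiskerRight, Category.assoc, lcomp_lev, associator_naturality_middle_assoc,
    ← MonoidalCategory.whiskerLeft_comp_assoc, lid_lev]
  simp

lemma lcomp_assoc (W X Y Z : V) :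
    lcomp X Y Z ▷ lhom W X ≫ lcomp W X Z =
      (α_ _ _ _).hom ≫ lhom Y Z ◁ lcomp W X Y ≫ lcomp W Y Z := by
  apply lhom_ext
  simp only [comp_whiskerRight, Category.assoc, lcomp_lev, associator_naturality_left_assoc,
    associator_naturality_middle_assoc]
  rw [← whisker_exchange_assoc, lcomp_lev, ← MonoidalCategory.whiskerLeft_comp_assoc _ (_ ▷ W),
    lcomp_lev]
  simp

/-! ### The endomorphism monoids `V_B(X, X)` and `V^B(M, M)` -/

/-- Composition `V_B(Y, Z) ⊗ V_B(X, Y) ⟶ V_B(X, Z)` in the Kleisli `V`-category of `- ⊗ B`,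
where `V_B(X, Y) = [X, Y ⊗ B]`. -/
def kleisliComp (B : Mon V) (X Y Z : V) :
    lhom Y (Z ⊗ B.X) ⊗ lhom X (Y ⊗ B.X) ⟶ lhom X (Z ⊗ B.X) :=
  lwhisker Y (Z ⊗ B.X) B.X ▷ lhom X (Y ⊗ B.X) ≫ lcomp X (Y ⊗ B.X) ((Z ⊗ B.X) ⊗ B.X) ≫
    (ihom X).map ((α_ Z B.X B.X).hom ≫ Z ◁ B.mon.mul)

/-- The identity `𝟙_ V ⟶ V_B(X, X)`. -/
def kleisliId (B : Mon V) (X : V) : 𝟙_ V ⟶ lhom X (X ⊗ B.X) :=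
  lid X ≫ (ihom X).map ((ρ_ X).inv ≫ X ◁ B.mon.one)

lemma kleisliComp_lev (B : Mon V) (X Y Z : V) :
    kleisliComp B X Y Z ▷ X ≫ lev X (Z ⊗ B.X) =
      (α_ _ _ _).hom ≫ lhom Y (Z ⊗ B.X) ◁ lev X (Y ⊗ B.X) ≫ (α_ _ _ _).inv ≫
        lev Y (Z ⊗ B.X) ▷ B.X ≫ (α_ Z B.X B.X).hom ≫ Z ◁ B.mon.mul := by
  simp only [kleisliComp, comp_whiskerRight, Category.assoc]
  rw [ihom_map_lev, reassoc_of% @lcomp_lev, associator_naturality_left_assoc,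
    ← whisker_exchange_assoc, reassoc_of% @lwhisker_lev]

lemma kleisliId_lev (B : Mon V) (X : V) :
    kleisliId B X ▷ X ≫ lev X (X ⊗ B.X) = (λ_ X).hom ≫ (ρ_ X).inv ≫ X ◁ B.mon.one := by
  rw [kleisliId, comp_whiskerRight, Category.assoc, ihom_map_lev, reassoc_of% @lid_lev]

/-- The monoid `V_B(X, X) = [X, X ⊗ B]` of endomorphisms of `X` in the Kleisli `V`-category. -/
def kleisliEnd (B : Mon V) (X : V) : Mon V where
  X := lhom X (X ⊗ B.X)
  mon :=
    { one := kleisliId B X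
      mul := kleisliComp B X X X
      one_mul := by
        apply lhom_ext
        rw [comp_whiskerRight, Category.assoc, kleisliComp_lev, associator_naturality_left_assoc,
          ← whisker_exchange_assoc, associator_inv_naturality_left_assoc,
          ← comp_whiskerRight_assoc, kleisliId_lev]
        have h : ((ρ_ X).inv ≫ X ◁ B.mon.one) ▷ B.X ≫ (α_ X B.X B.X).hom ≫ X ◁ B.mon.mul =
            𝟙 _ := by
          simpa using kl_comp_pure B (𝟙 (X ⊗ B.X)) (𝟙 X)
        rw [comp_whiskerRight, Category.assoc, h]
        simp
      mul_one := by
        apply lhom_ext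
        have h := kl_pure_comp B (𝟙 _) (lev X (X ⊗ B.X))
        rw [comp_whiskerRight, Category.assoc, kleisliComp_lev, associator_naturality_middle_assoc,
          ← MonoidalCategory.whiskerLeft_comp_assoc, kleisliId_lev]
        simp only [MonoidalCategory.whiskerLeft_comp, Category.assoc, whiskerLeft_rightUnitor_inv,
          Category.id_comp] at h ⊢
        rw [associator_inv_naturality_right_assoc, Iso.hom_inv_id_assoc, h]
        simp
      mul_assoc := by
        apply lhom_ext
        simp only [comp_whiskerRight, Category.assoc, kleisliComp_lev,
          associator_naturality_left_assoc, associator_naturality_middle_assoc]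
        rw [← whisker_exchange_assoc, associator_inv_naturality_left_assoc,
          ← comp_whiskerRight_assoc (_ ▷ X), kleisliComp_lev,
          ← MonoidalCategory.whiskerLeft_comp_assoc _ (_ ▷ X), kleisliComp_lev]
        simp only [MonoidalCategory.whiskerLeft_comp, Category.assoc, comp_whiskerRight]
        rw [associator_naturality_middle_assoc X, ← MonoidalCategory.whiskerLeft_comp X,
          MonObj.mul_assoc, MonoidalCategory.whiskerLeft_comp, MonoidalCategory.whiskerLeft_comp,
          associator_inv_naturality_right_assoc, whisker_exchange_assoc,
          associator_naturality_right_assoc]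
        monoidal }

/-- The first of the two morphisms `[M, N] ⟶ [M ⊗ B, N]` whose equalizer is `V^B(M, N)`: apply
`- ⊗ B`, then compose with the action of `N`. -/
def emLeft {B : Mon V} (M N : EMCat B) : lhom M.A N.A ⟶ lhom (M.A ⊗ B.X) N.A :=
  lwhisker M.A N.A B.X ≫ (ihom (M.A ⊗ B.X)).map (emAct N)

/-- The second of the two morphisms `[M, N] ⟶ [M ⊗ B, N]` whose equalizer is `V^B(M, N)`:
precompose with the action of `M`. -/
def emRight {B : Mon V} (M N : EMCat B) : lhom M.A N.A ⟶ lhom (M.A ⊗ B.X) N.A :=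
  lpre (emAct M) N.A

lemma emHom_cond_iff {B : Mon V} (M N : EMCat B) {Z : V} (g : Z ⟶ lhom M.A N.A) :
    g ≫ emLeft M N = g ≫ emRight M N ↔
      (α_ Z M.A B.X).inv ≫ (g ▷ M.A ≫ lev M.A N.A) ▷ B.X ≫ emAct N =
        Z ◁ emAct M ≫ g ▷ M.A ≫ lev M.A N.A := by
  have h1 : (g ≫ emLeft M N) ▷ (M.A ⊗ B.X) ≫ lev _ _ =
      (α_ Z M.A B.X).inv ≫ (g ▷ M.A ≫ lev M.A N.A) ▷ B.X ≫ emAct N := by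
    simp only [emLeft, comp_whiskerRight, Category.assoc]
    rw [ihom_map_lev, reassoc_of% @lwhisker_lev, associator_inv_naturality_left_assoc]
  have h2 : (g ≫ emRight M N) ▷ (M.A ⊗ B.X) ≫ lev _ _ =
      Z ◁ emAct M ≫ g ▷ M.A ≫ lev M.A N.A := by
    simp only [emRight, comp_whiskerRight, Category.assoc]
    rw [lpre_lev, ← whisker_exchange_assoc]
  rw [← h1, ← h2]
  exact ⟨fun h => by rw [h], fun h => lhom_ext h⟩

/-- The hom object `V^B(M, N)` of the `V`-category of Eilenberg-Moore algebras. -/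
def emHom {B : Mon V} (M N : EMCat B) [HasEqualizer (emLeft M N) (emRight M N)] : V :=
  equalizer (emLeft M N) (emRight M N)

/-- The inclusion `V^B(M, N) ⟶ [M, N]`. -/
def emι {B : Mon V} (M N : EMCat B) [HasEqualizer (emLeft M N) (emRight M N)] :
    emHom M N ⟶ lhom M.A N.A := equalizer.ι _ _

section emEnd

variable {B : Mon V} (M : EMCat B) [HasEqualizer (emLeft M M) (emRight M M)]

instance : Mono (emι M M) := inferInstanceAs (Mono (equalizer.ι _ _))

lemma emι_cond : (α_ (emHom M M) M.A B.X).inv ≫ (emι M M ▷ M.A ≫ lev M.A M.A) ▷ B.X ≫ emAct M =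
    emHom M M ◁ emAct M ≫ emι M M ▷ M.A ≫ lev M.A M.A :=
  (emHom_cond_iff M M _).1 (equalizer.condition _ _)

/-- The identity of `V^B(M, M)`. -/
def emId : 𝟙_ V ⟶ emHom M M := equalizer.lift (lid M.A) (by
  rw [emHom_cond_iff, lid_lev]
  simp)

/-- The composition of `V^B(M, M)`. -/
def emComp : emHom M M ⊗ emHom M M ⟶ emHom M M :=
  equalizer.lift ((emι M M ⊗ₘ emι M M) ≫ lcomp M.A M.A M.A) (by
    rw [emHom_cond_iff]
    have e : ((emι M M ⊗ₘ emι M M) ≫ lcomp M.A M.A M.A) ▷ M.A ≫ lev M.A M.A =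
        (α_ _ _ _).hom ≫ emHom M M ◁ (emι M M ▷ M.A ≫ lev M.A M.A) ≫
          emι M M ▷ M.A ≫ lev M.A M.A := by
      rw [comp_whiskerRight, Category.assoc, lcomp_lev, tensorHom_def']
      simp only [comp_whiskerRight, Category.assoc, MonoidalCategory.whiskerLeft_comp]
      rw [associator_naturality_left_assoc, ← whisker_exchange_assoc,
        associator_naturality_middle_assoc]
    rw [e]
    have h := emι_cond M
    generalize emι M M ▷ M.A ≫ lev M.A M.A = u at h ⊢
    have h' := congrArg (emHom M M ◁ ·) h
    simp only [MonoidalCategory.whiskerLeft_comp] at h'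
    simp only [comp_whiskerRight, Category.assoc, whisker_assoc]
    rw [h]
    have h'' := congrArg (fun t => (α_ (emHom M M) (emHom M M) (M.A ⊗ B.X)).hom ≫ t ≫ u) h'
    simp only [Category.assoc] at h''
    rw [tensor_whiskerLeft, Category.assoc, Category.assoc, Iso.inv_hom_id_assoc, ← h'']
    simp)

@[simp]
lemma emId_ι : emId M ≫ emι M M = lid M.A := equalizer.lift_ι _ _

@[simp]
lemma emComp_ι : emComp M ≫ emι M M = (emι M M ⊗ₘ emι M M) ≫ lcomp M.A M.A M.A :=
  equalizer.lift_ι _ _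

/-- The monoid `V^B(M, M)` of endomorphisms of `M` in the Eilenberg-Moore `V`-category. -/
def emEnd : Mon V where
  X := emHom M M
  mon :=
    { one := emId M
      mul := emComp M
      one_mul := by
        rw [← cancel_mono (emι M M), Category.assoc, emComp_ι, tensorHom_def',
          Category.assoc, ← whisker_exchange_assoc, ← comp_whiskerRight_assoc, emId_ι, lid_lcomp,
          leftUnitor_naturality]
      mul_one := by
        rw [← cancel_mono (emι M M), Category.assoc, emComp_ι,
          MonoidalCategory.tensorHom_def, Category.assoc, whisker_exchange_assoc,
          ← MonoidalCategory.whiskerLeft_comp_assoc, emId_ι, lcomp_lid, rightUnitor_naturality]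
      mul_assoc := by
        rw [← cancel_mono (emι M M)]
        simp only [Category.assoc, emComp_ι]
        have h1 : emComp M ▷ emHom M M ≫ (emι M M ⊗ₘ emι M M) =
            ((emι M M ⊗ₘ emι M M) ⊗ₘ emι M M) ≫ lcomp M.A M.A M.A ▷ _ := by
          rw [← tensorHom_id, ← tensorHom_id, tensorHom_comp_tensorHom, emComp_ι,
            tensorHom_comp_tensorHom, Category.id_comp, Category.comp_id]
        have h2 : emHom M M ◁ emComp M ≫ (emι M M ⊗ₘ emι M M) =
            (emι M M ⊗ₘ emι M M ⊗ₘ emι M M) ≫ _ ◁ lcomp M.A M.A M.A := by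
          rw [← id_tensorHom, ← id_tensorHom, tensorHom_comp_tensorHom, emComp_ι,
            tensorHom_comp_tensorHom, Category.id_comp, Category.comp_id]
        rw [reassoc_of% h1, reassoc_of% h2, lcomp_assoc, associator_naturality_assoc] }

end emEnd

section FreeHom

variable (B : Mon V) (X : V) (N : EMCat B)

/-- The comparison `[X, N] ⟶ [X ⊗ B, N]`. -/
def freeHom : lhom X N.A ⟶ lhom (X ⊗ B.X) N.A :=
  lcurry ((α_ _ _ _).inv ≫ lev X N.A ▷ B.X ≫ emAct N)

lemma freeHom_lev : freeHom B X N ▷ (X ⊗ B.X) ≫ lev (X ⊗ B.X) N.A =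
    (α_ _ _ _).inv ≫ lev X N.A ▷ B.X ≫ emAct N := lcurry_lev _

lemma freeHom_cond :
    freeHom B X N ≫ emLeft (freeAlg B X) N = freeHom B X N ≫ emRight (freeAlg B X) N := by
  refine (emHom_cond_iff (freeAlg B X) N (freeHom B X N)).2 ?_
  rw [freeHom_lev]
  have h := emAct_emAct B N
  simp only [comp_whiskerRight, Category.assoc]
  rw [h]
  have e : emAct (freeAlg B X) = (α_ X B.X B.X).hom ≫ X ◁ B.mon.mul := rfl
  rw [e, MonoidalCategory.whiskerLeft_comp, Category.assoc, associator_inv_naturality_right_assoc,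
    whisker_exchange_assoc, associator_naturality_left_assoc]
  simp

lemma freeHom_pre :
    freeHom B X N ≫ lpre ((ρ_ X).inv ≫ X ◁ B.mon.one) N.A = 𝟙 _ := by
  apply lhom_ext
  rw [comp_whiskerRight, Category.assoc, lpre_lev, ← whisker_exchange_assoc, freeHom_lev]
  have h := emAct_one B N
  rw [MonoidalCategory.whiskerLeft_comp, Category.assoc, associator_inv_naturality_right_assoc,
    whisker_exchange_assoc, whiskerLeft_rightUnitor_inv, Category.assoc, Iso.hom_inv_id_assoc,
    ← rightUnitor_inv_naturality_assoc, h]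
  simp

lemma pre_freeHom {Z : V} (g : Z ⟶ lhom (X ⊗ B.X) N.A)
    (hg : g ≫ emLeft (freeAlg B X) N = g ≫ emRight (freeAlg B X) N) :
    (g ≫ lpre ((ρ_ X).inv ≫ X ◁ B.mon.one) N.A) ≫ freeHom B X N = g := by
  replace hg := (emHom_cond_iff (freeAlg B X) N g).1 hg
  apply lhom_ext
  have e : (g ≫ lpre ((ρ_ X).inv ≫ X ◁ B.mon.one) N.A) ▷ X ≫ lev X N.A =
      Z ◁ ((ρ_ X).inv ≫ X ◁ B.mon.one) ≫ g ▷ (X ⊗ B.X) ≫ lev (X ⊗ B.X) N.A := by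
    rw [comp_whiskerRight, Category.assoc, lpre_lev, ← whisker_exchange_assoc]
  have h : ((ρ_ X).inv ≫ X ◁ B.mon.one) ▷ B.X ≫ (α_ X B.X B.X).hom ≫ X ◁ B.mon.mul = 𝟙 _ := by
    simpa using kl_comp_pure B (𝟙 (X ⊗ B.X)) (𝟙 X)
  rw [comp_whiskerRight, Category.assoc, freeHom_lev, associator_inv_naturality_left_assoc,
    ← comp_whiskerRight_assoc, e]
  generalize g ▷ (X ⊗ B.X) ≫ lev (X ⊗ B.X) N.A = u at hg ⊢
  rw [comp_whiskerRight, Category.assoc, whisker_assoc, Category.assoc, Category.assoc,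
    Iso.inv_hom_id_assoc, hg, ← MonoidalCategory.whiskerLeft_comp_assoc]
  exact (congrArg (fun t => Z ◁ t ≫ u) h).trans (by simp)

/-- The equalizer defining `V^B(X ⊗ B, N)` always exists; it is `[X, N]`. -/
instance hasEqualizer_freeAlg : HasEqualizer (emLeft (freeAlg B X) N) (emRight (freeAlg B X) N) :=
  ⟨⟨⟨Fork.ofι (freeHom B X N) (freeHom_cond B X N), Fork.IsLimit.mk _
    (fun s => s.ι ≫ lpre ((ρ_ X).inv ≫ X ◁ B.mon.one) N.A)
    (fun s => pre_freeHom B X N s.ι s.condition)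
    (fun s m hm => by
      have h : m ≫ freeHom B X N = s.ι := hm
      rw [← h, Category.assoc, freeHom_pre]
      exact (Category.comp_id _).symm)⟩⟩⟩

end FreeHom

/-! ### The convolution monoid and the universal measuring comonoid -/

section Conv

variable (C : Comon V) (B : Mon V)

/-- The convolution product `[C, B] ⊗ [C, B] ⟶ [C ⊗ C, B ⊗ B] ⟶ [C, B]`; the first morphism is
the monoidal structure of the internal hom, induced by the braided interchange. -/
def convMul : lhom C.X B.X ⊗ lhom C.X B.X ⟶ lhom C.X B.X :=
  lcurry (Z := lhom C.X B.X ⊗ lhom C.X B.X) (X := C.X ⊗ C.X) (Y := B.X ⊗ B.X)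
      (tensorδ (lhom C.X B.X) C.X (lhom C.X B.X) C.X ≫ (lev C.X B.X ⊗ₘ lev C.X B.X)) ≫
    lpre C.comon.comul (B.X ⊗ B.X) ≫ (ihom C.X).map B.mon.mul

/-- The convolution unit `𝟙_ V ⟶ [𝟙_ V, 𝟙_ V] ⟶ [C, B]`. -/
def convOne : 𝟙_ V ⟶ lhom C.X B.X :=
  lid (𝟙_ V) ≫ lpre C.comon.counit (𝟙_ V) ≫ (ihom C.X).map B.mon.one

lemma convMul_lev : convMul C B ▷ C.X ≫ lev C.X B.X =
    (lhom C.X B.X ⊗ lhom C.X B.X) ◁ C.comon.comul ≫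
      tensorδ (lhom C.X B.X) C.X (lhom C.X B.X) C.X ≫ (lev C.X B.X ⊗ₘ lev C.X B.X) ≫
        B.mon.mul := by
  simp only [convMul, comp_whiskerRight, Category.assoc]
  rw [ihom_map_lev, reassoc_of% @lpre_lev, ← whisker_exchange_assoc, reassoc_of% @lcurry_lev,
    Category.assoc]

lemma convOne_lev : convOne C B ▷ C.X ≫ lev C.X B.X =
    𝟙_ V ◁ C.comon.counit ≫ (λ_ (𝟙_ V)).hom ≫ B.mon.one := by
  simp only [convOne, comp_whiskerRight, Category.assoc]
  rw [ihom_map_lev, reassoc_of% @lpre_lev, ← whisker_exchange_assoc, reassoc_of% @lid_lev]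

/-- Uncurried form of the convolution product of two generalised elements. -/
lemma convMul_gen {Z W : V} (f : Z ⟶ lhom C.X B.X) (g : W ⟶ lhom C.X B.X) :
    ((f ⊗ₘ g) ≫ convMul C B) ▷ C.X ≫ lev C.X B.X =
      (Z ⊗ W) ◁ C.comon.comul ≫ tensorδ Z C.X W C.X ≫
        ((f ▷ C.X ≫ lev C.X B.X) ⊗ₘ (g ▷ C.X ≫ lev C.X B.X)) ≫ B.mon.mul := by
  have e := tensorδ_natural f (𝟙 C.X) g (𝟙 C.X)
  rw [id_tensorHom_id, tensorHom_id, tensorHom_id, tensorHom_id] at e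
  rw [comp_whiskerRight, Category.assoc, convMul_lev, ← whisker_exchange_assoc,
    reassoc_of% e, tensorHom_comp_tensorHom_assoc]

/-- The monoid `[C, B]` under convolution. -/
def convMon : Mon V where
  X := lhom C.X B.X
  mon :=
    { one := convOne C B
      mul := convMul C B
      one_mul := by
        apply lhom_ext
        have e1 : convOne C B ▷ lhom C.X B.X = (convOne C B ⊗ₘ 𝟙 _) := (tensorHom_id _ _).symm
        have e2 := tensorδ_natural (𝟙 (𝟙_ V)) C.comon.counit (𝟙 (lhom C.X B.X)) (𝟙 C.X)
        have e3 := congrArg ((𝟙_ V ⊗ lhom C.X B.X) ◁ ·) C.comon.counit_comul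
        rw [id_tensorHom_id, id_tensorHom_id, id_tensorHom, id_tensorHom, tensorHom_id] at e2
        simp only [MonoidalCategory.whiskerLeft_comp] at e3
        rw [e1, convMul_gen, convOne_lev, id_whiskerRight, ← tensorHom_comp_tensorHom_assoc,
          ← reassoc_of% e2, reassoc_of% e3]
        have e4 : ((λ_ (𝟙_ V)).hom ≫ B.mon.one ⊗ₘ lev C.X B.X) ≫ B.mon.mul =
            (λ_ (𝟙_ V)).hom ▷ (lhom C.X B.X ⊗ C.X) ≫ (λ_ _).hom ≫ lev C.X B.X := by
          rw [← MonObj.one_mul_hom (lev C.X B.X), ← tensorHom_id, tensorHom_comp_tensorHom_assoc,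
            Category.id_comp]
        rw [e4, reassoc_of% @tensorδ_left, MonoidalCategory.tensorHom_def', Category.assoc,
          ← MonoidalCategory.whiskerLeft_comp_assoc, Iso.inv_hom_id,
          MonoidalCategory.whiskerLeft_id, Category.id_comp]
      mul_one := by
        apply lhom_ext
        have e1 : lhom C.X B.X ◁ convOne C B = (𝟙 _ ⊗ₘ convOne C B) := (id_tensorHom _ _).symm
        have e2 := tensorδ_natural (𝟙 (lhom C.X B.X)) (𝟙 C.X) (𝟙 (𝟙_ V)) C.comon.counit
        have e3 := congrArg ((lhom C.X B.X ⊗ 𝟙_ V) ◁ ·) C.comon.comul_counit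
        rw [id_tensorHom_id, id_tensorHom_id, id_tensorHom, id_tensorHom, id_tensorHom,
          id_tensorHom] at e2
        simp only [MonoidalCategory.whiskerLeft_comp] at e3
        have e4 : (𝟙 (lhom C.X B.X) ▷ C.X ≫ lev C.X B.X ⊗ₘ
            𝟙_ V ◁ C.comon.counit ≫ (λ_ (𝟙_ V)).hom ≫ B.mon.one) ≫ B.mon.mul =
            (lhom C.X B.X ⊗ C.X) ◁ 𝟙_ V ◁ C.comon.counit ≫
              (lhom C.X B.X ⊗ C.X) ◁ (λ_ (𝟙_ V)).hom ≫ (ρ_ _).hom ≫ lev C.X B.X := by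
          rw [← MonObj.mul_one_hom (lev C.X B.X), ← id_tensorHom (lhom C.X B.X ⊗ C.X),
            ← id_tensorHom (lhom C.X B.X ⊗ C.X) (λ_ (𝟙_ V)).hom,
            tensorHom_comp_tensorHom_assoc, tensorHom_comp_tensorHom_assoc]
          simp only [Category.id_comp, id_whiskerRight, Category.assoc]
        rw [e1, convMul_gen, convOne_lev, e4, ← reassoc_of% e2, reassoc_of% e3,
          reassoc_of% @tensorδ_right, MonoidalCategory.tensorHom_def', Category.assoc,
          ← MonoidalCategory.whiskerLeft_comp_assoc, Iso.inv_hom_id,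
          MonoidalCategory.whiskerLeft_id, Category.id_comp]
      mul_assoc := by
        apply lhom_ext
        have e1 : convMul C B ▷ lhom C.X B.X = (convMul C B ⊗ₘ 𝟙 _) := (tensorHom_id _ _).symm
        have e2 : lhom C.X B.X ◁ convMul C B = (𝟙 _ ⊗ₘ convMul C B) := (id_tensorHom _ _).symm
        rw [e1, convMul_gen, convMul_lev, e2, comp_whiskerRight, Category.assoc, convMul_gen,
          convMul_lev, id_whiskerRight]
        exact conv_assoc (lev C.X B.X) C.comon.comul B.mon.mul C.comon.comul_assoc
          B.mon.mul_assoc }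

end Conv

lemma lpre_one {C D : Comon V} (B : Mon V) (f : C ⟶ D) :
    convOne D B ≫ lpre f.hom B.X = convOne C B := by
  apply lhom_ext
  rw [comp_whiskerRight, Category.assoc, lpre_lev, ← whisker_exchange_assoc, convOne_lev,
    convOne_lev, ← MonoidalCategory.whiskerLeft_comp_assoc, IsComonHom.hom_counit]

lemma lpre_mul {C D : Comon V} (B : Mon V) (f : C ⟶ D) :
    convMul D B ≫ lpre f.hom B.X = (lpre f.hom B.X ⊗ₘ lpre f.hom B.X) ≫ convMul C B := by
  apply lhom_ext
  rw [comp_whiskerRight, Category.assoc, lpre_lev, ← whisker_exchange_assoc, convMul_lev,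
    convMul_gen, lpre_lev, ← MonoidalCategory.whiskerLeft_comp_assoc, IsComonHom.hom_comul]
  have e := tensorδ_natural (𝟙 (lhom D.X B.X)) f.hom (𝟙 (lhom D.X B.X)) f.hom
  rw [id_tensorHom_id, id_tensorHom, id_tensorHom] at e
  rw [MonoidalCategory.whiskerLeft_comp, Category.assoc, reassoc_of% e,
    tensorHom_comp_tensorHom_assoc]

/-- The functor `[-, B]` from comonoids to monoids. -/
def convFunctor (B : Mon V) : (Comon V)ᵒᵖ ⥤ Mon V where
  obj C := convMon C.unop B
  map {C D} f :=
    Mon.Hom.mk' (M := convMon C.unop B) (N := convMon D.unop B) (lpre f.unop.hom B.X)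
      (lpre_one B f.unop) (lpre_mul B f.unop)
  map_id C := Mon.Hom.ext (lhom_ext (by
    change lpre (𝟙 C.unop.X) B.X ▷ C.unop.X ≫ _ = 𝟙 (lhom C.unop.X B.X) ▷ C.unop.X ≫ _
    simp))
  map_comp {C D E} f g := Mon.Hom.ext (lhom_ext (by
    change lpre (g.unop.hom ≫ f.unop.hom) B.X ▷ E.unop.X ≫ lev _ _ =
      (lpre f.unop.hom B.X ≫ lpre g.unop.hom B.X) ▷ E.unop.X ≫ lev _ _
    rw [comp_whiskerRight, Category.assoc, lpre_lev, lpre_lev, ← whisker_exchange_assoc, lpre_lev]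
    simp))

/-- The functor `C ↦ Mon(V)(A, [C, B])` on comonoids. -/
def measuringFunctor (A B : Mon V) : (Comon V)ᵒᵖ ⥤ Type v :=
  convFunctor B ⋙ coyoneda.obj (op A)

/-- `P` is the universal measuring comonoid `P(A, B)`: it comes with a bijection
`Comon(V)(C, P) ≃ Mon(V)(A, [C, B])`, natural in the comonoid `C`. -/
abbrev UniversalMeasuring (A B : Mon V) (P : Comon V) :=
  (measuringFunctor A B).RepresentableBy P

/-- The universal measuring `A ⊗ P(A, B) ⟶ B`, the transpose of the monoid morphism
`A ⟶ [P(A, B), B]` that corresponds to the identity of `P(A, B)`. -/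
def universalMeasuring {A B : Mon V} {P : Comon V} (hP : UniversalMeasuring A B P) :
    A.X ⊗ P.X ⟶ B.X :=
  lcurry.symm (Mon.Hom.hom (M := A) (N := convMon P B) (hP.homEquiv (𝟙 P)))

end Closed

/-! ### Right comodules -/

/-- A right comodule structure over the comonoid `P` on the object `X`. -/
@[ext]
structure ComodOn (P : Comon V) (X : V) where
  /-- The coaction. -/
  coact : X ⟶ X ⊗ P.X
  coact_counit : coact ≫ X ◁ P.comon.counit = (ρ_ X).inv
  coact_coact : coact ≫ coact ▷ P.X ≫ (α_ X P.X P.X).hom = coact ≫ X ◁ P.comon.comul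

/-- A right comodule over the comonoid `P`. -/
structure RightComod (P : Comon V) where
  /-- The underlying object. -/
  X : V
  /-- The comodule structure. -/
  str : ComodOn P X

namespace RightComod

variable {P : Comon V}

/-- A morphism of right comodules. -/
@[ext]
structure Hom (M N : RightComod P) where
  /-- The underlying morphism. -/
  hom : M.X ⟶ N.X
  comm : M.str.coact ≫ hom ▷ P.X = hom ≫ N.str.coact

instance : Category (RightComod P) where
  Hom := Hom
  id M := { hom := 𝟙 M.X, comm := by simp }
  comp f g := { hom := f.hom ≫ g.hom
                comm := by rw [comp_whiskerRight, ← Category.assoc, f.comm, Category.assoc, g.comm,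
                  Category.assoc] }

/-- The forgetful functor to `V`. -/
def forget (P : Comon V) : RightComod P ⥤ V where
  obj M := M.X
  map f := f.hom

end RightComod

/-- The category of right `P`-comodules whose underlying object is dualizable. -/
abbrev DualizableComod (P : Comon V) :=
  ObjectProperty.FullSubcategory fun M : RightComod P => IsDualizable M.X

/-! ### The category `^A V_B` -/

/-- A morphism `ψ : A ⊗ X ⟶ X ⊗ B` compatible with the multiplications and units of `A` and
`B`. -/
@[ext]
structure TwistOn (A B : Mon V) (X : V) where
  /-- The morphism `ψ`. -/
  ψ : A.X ⊗ X ⟶ X ⊗ B.X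
  ψ_mul : (α_ A.X A.X X).hom ≫ A.X ◁ ψ ≫ (α_ A.X X B.X).inv ≫ ψ ▷ B.X ≫ (α_ X B.X B.X).hom ≫
    X ◁ B.mon.mul = A.mon.mul ▷ X ≫ ψ
  ψ_one : (λ_ X).inv ≫ A.mon.one ▷ X ≫ ψ = (ρ_ X).inv ≫ X ◁ B.mon.one

/-- An object of `^A V_B`. -/
structure TwistCat (A B : Mon V) where
  /-- The underlying object. -/
  X : V
  /-- The structure morphism `A ⊗ X ⟶ X ⊗ B` with its axioms. -/
  str : TwistOn A B X

namespace TwistCat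

variable {A B : Mon V}

/-- A morphism `(X, ψ) ⟶ (X', ψ')` of `^A V_B`. -/
@[ext]
structure Hom (M N : TwistCat A B) where
  /-- The underlying morphism. -/
  hom : M.X ⟶ N.X
  comm : M.str.ψ ≫ hom ▷ B.X = A.X ◁ hom ≫ N.str.ψ

instance : Category (TwistCat A B) where
  Hom := Hom
  id M := { hom := 𝟙 M.X, comm := by simp }
  comp f g := { hom := f.hom ≫ g.hom
                comm := by rw [comp_whiskerRight, ← Category.assoc, f.comm, Category.assoc, g.comm,
                  MonoidalCategory.whiskerLeft_comp, Category.assoc] }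

/-- The forgetful functor to `V`. -/
def forget (A B : Mon V) : TwistCat A B ⥤ V where
  obj M := M.X
  map f := f.hom

end TwistCat

/-- The category of dualizable objects of `^A V_B`. -/
abbrev DualizableTwist (A B : Mon V) :=
  ObjectProperty.FullSubcategory fun M : TwistCat A B => IsDualizable M.X

/-- The morphism `A ⊗ X ⟶ X ⊗ B` obtained from a coaction `X ⟶ X ⊗ P` of a universal measuring
comonoid `P` of `A` and `B`: coact, move `A` past `X`, then apply the universal measuring. -/
def twistOfCoact [BraidedCategory V] [MonoidalClosed V] {A B : Mon V} {P : Comon V}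
    (hP : UniversalMeasuring A B P) {X : V} (coact : X ⟶ X ⊗ P.X) : A.X ⊗ X ⟶ X ⊗ B.X :=
  A.X ◁ coact ≫ (α_ A.X X P.X).inv ≫ (β_ X A.X).inv ▷ P.X ≫ (α_ X A.X P.X).hom ≫
    X ◁ universalMeasuring hP

end Sweedler

end

/-! The five descriptions in (1) are transposes of one another. Composition in the Kleisli category
is composition of the extensions `klExt`, extension is injective, and an algebra map out of a free
algebra is the extension of its restriction along the unit. So each algebra or monoid axiom unwinds
to one of the two equations (*).

For (2), let `Y` be a dual of `X`. Then `Y ⊗ X` is a comonoid that coacts on `X`, and comodule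
structures over `P` on `X` are the transposes of comonoid morphisms `Y ⊗ X ⟶ P`. By the universal
property these are the measurings `A ⊗ (Y ⊗ X) ⟶ B`. Duality and the braiding identify arbitrary
morphisms `A ⊗ (Y ⊗ X) ⟶ B` with morphisms `A ⊗ X ⟶ X ⊗ B` (`slide_coev`), and `slide_conv` shows
that the measuring axioms become (*).

For (3), the direct implication is naturality of `slide`. For the converse, a morphism `f : X ⟶ X'`
is one of comodules exactly when two composites `Y' ⊗ X ⟶ P` agree, one through `Y ⊗ X` and one
through `Y' ⊗ X'`. The universal property does not apply directly, since `Y' ⊗ X` is not a comonoid.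
However, the pushout of `Y ⊗ X` and `Y' ⊗ X'` over `Y' ⊗ X` is a comonoid. If `f` respects the
twists, the two measurings glue to a measuring on this pushout, hence to a comonoid morphism into
`P`. By uniqueness it restricts to the two given morphisms, so the composites agree
(`comod_comm_of_twist_comm`). The case `f = 𝟙 X` also yields injectivity in (2). -/

noncomputable section

namespace Sweedler

/-! ### Twists as algebras in the Kleisli category and on free algebras -/

section KleisliAlgebras

variable {V : Type u} [Category.{v} V] [MonoidalCategory V] {A B : Mon V} {X Y Z : V}

/-- A morphism `A ⊗ X ⟶ X ⊗ B` as a morphism `A ⊗ X ⟶ X` of the Kleisli category. -/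
def klAct (ψ : A.X ⊗ X ⟶ X ⊗ B.X) :
    (kleisliMonad A B).obj (Kleisli.mk _ X) ⟶ Kleisli.mk (tensorRightMonad B) X := ⟨ψ⟩

/-- The unit of the monad lies in the image of `V`, and Kleisli composition after such a morphism is
plain composition (`kl_pure_comp`); the rest holds by unfolding. -/
lemma kleisliMonad_unit_iff (ψ : A.X ⊗ X ⟶ X ⊗ B.X) :
    (kleisliMonad A B).η.app (Kleisli.mk _ X) ≫ klAct ψ = 𝟙 _ ↔
      (λ_ X).inv ≫ A.mon.one ▷ X ≫ ψ = (ρ_ X).inv ≫ X ◁ B.mon.one := by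
  have h := kl_pure_comp B ((λ_ X).inv ≫ A.mon.one ▷ X) ψ
  rw [← Category.assoc, ← h]
  exact ⟨fun e => congrArg Kleisli.Hom.of e, fun e => Kleisli.hom_ext e⟩

lemma kleisliMonad_assoc_iff (ψ : A.X ⊗ X ⟶ X ⊗ B.X) :
    (kleisliMonad A B).μ.app (Kleisli.mk _ X) ≫ klAct ψ =
        (kleisliMonad A B).map (klAct ψ) ≫ klAct ψ ↔
      (α_ A.X A.X X).hom ≫ A.X ◁ ψ ≫ (α_ A.X X B.X).inv ≫ ψ ▷ B.X ≫ (α_ X B.X B.X).hom ≫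
        X ◁ B.mon.mul = A.mon.mul ▷ X ≫ ψ := by
  have h := kl_pure_comp B ((α_ A.X A.X X).inv ≫ A.mon.mul ▷ X) ψ
  rw [eq_comm, eq_comm (b := A.mon.mul ▷ X ≫ ψ), ← Iso.inv_comp_eq, ← Category.assoc, ← h,
    eq_comm, ← Category.assoc (A.X ◁ ψ)]
  exact ⟨fun e => congrArg Kleisli.Hom.of e, fun e => Kleisli.hom_ext e⟩

/-- Algebra structures in the Kleisli category are morphisms satisfying the twist axioms. -/
def twistEquivKleisliAlgebra (A B : Mon V) (X : V) :
    TwistOn A B X ≃ AlgebraOn (kleisliMonad A B) (Kleisli.mk _ X) where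
  toFun s := ⟨klAct s.ψ, (kleisliMonad_unit_iff _).2 s.ψ_one, (kleisliMonad_assoc_iff _).2 s.ψ_mul⟩
  invFun ξ := ⟨ξ.a.of, (kleisliMonad_assoc_iff _).1 ξ.assoc, (kleisliMonad_unit_iff _).1 ξ.unit⟩
  left_inv _ := rfl
  right_inv _ := rfl

/-- The Kleisli extension `Z ⊗ B ⟶ X ⊗ B` of `f : Z ⟶ X ⊗ B`. -/
def klExt (B : Mon V) (f : Z ⟶ X ⊗ B.X) : Z ⊗ B.X ⟶ X ⊗ B.X :=
  f ▷ B.X ≫ (α_ X B.X B.X).hom ≫ X ◁ B.mon.mul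

lemma pure_klExt (f : Z ⟶ X ⊗ B.X) : (ρ_ Z).inv ≫ Z ◁ B.mon.one ≫ klExt B f = f := by
  simpa [klExt] using kl_pure_comp B (𝟙 Z) f

lemma klExt_pure : klExt B ((ρ_ X).inv ≫ X ◁ B.mon.one) = 𝟙 _ := by
  simpa [klExt] using kl_comp_pure B (𝟙 (X ⊗ B.X)) (𝟙 X)

lemma klExt_injective : Function.Injective (klExt B : (Z ⟶ X ⊗ B.X) → _) := fun f g h => by
  rw [← pure_klExt (B := B) f, h, pure_klExt]

lemma klExt_precomp (f : Z ⟶ Y) (g : Y ⟶ X ⊗ B.X) :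
    klExt B (f ≫ g) = f ▷ B.X ≫ klExt B g := by
  simp [klExt]

/-- Associativity of `B` makes an extension a morphism of free algebras. -/
lemma klExt_klExt (f : Z ⟶ X ⊗ B.X) :
    klExt B f ▷ B.X ≫ (α_ X B.X B.X).hom ≫ X ◁ B.mon.mul =
      (α_ Z B.X B.X).hom ≫ Z ◁ B.mon.mul ≫ klExt B f := by
  have h := congrArg (X ◁ ·) (MonObj.mul_assoc B.X)
  simp only [MonoidalCategory.whiskerLeft_comp] at h
  simp [klExt, whisker_exchange_assoc, h]

lemma klExt_comp (f : Z ⟶ Y ⊗ B.X) (g : Y ⟶ X ⊗ B.X) :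
    klExt B (f ≫ klExt B g) = klExt B f ≫ klExt B g := by
  rw [klExt_precomp, klExt, klExt_klExt]
  simp [klExt]

/-- The comparison from the Kleisli to the Eilenberg-Moore category carries tensoring on the left to
tensoring on the left, up to associators. -/
lemma klExt_whiskerLeft (W : V) (f : Z ⟶ X ⊗ B.X) :
    klExt B (W ◁ f ≫ (α_ W X B.X).inv) =
      (α_ W Z B.X).hom ≫ W ◁ klExt B f ≫ (α_ W X B.X).inv := by
  simp [klExt]

/-- A morphism of algebras out of a free algebra extends its restriction along the unit. -/
lemma klExt_restrict (g : Z ⊗ B.X ⟶ X ⊗ B.X)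
    (hg : g ▷ B.X ≫ (α_ X B.X B.X).hom ≫ X ◁ B.mon.mul =
      (α_ Z B.X B.X).hom ≫ Z ◁ B.mon.mul ≫ g) :
    klExt B ((ρ_ Z).inv ≫ Z ◁ B.mon.one ≫ g) = g := by
  have h := klExt_pure (X := Z) (B := B)
  rw [klExt, comp_whiskerRight] at h
  simp only [klExt, comp_whiskerRight, Category.assoc] at h ⊢
  rw [hg, reassoc_of% h]

lemma emMonad_freeAlg_unit_iff (ψ : A.X ⊗ X ⟶ X ⊗ B.X) :
    ((λ_ (X ⊗ B.X)).inv ≫ A.mon.one ▷ (X ⊗ B.X)) ≫ (α_ A.X X B.X).inv ≫ klExt B ψ = 𝟙 _ ↔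
      (λ_ X).inv ≫ A.mon.one ▷ X ≫ ψ = (ρ_ X).inv ≫ X ◁ B.mon.one := by
  rw [unit_tensor, Category.assoc, Iso.hom_inv_id_assoc, ← klExt_precomp, ← klExt_pure,
    klExt_injective.eq_iff, Category.assoc]

/-- After an isomorphism is cancelled, both sides are Kleisli extensions, so injectivity of `klExt`
reduces the law to the multiplicative twist axiom. -/
lemma emMonad_freeAlg_assoc_iff (ψ : A.X ⊗ X ⟶ X ⊗ B.X) :
    ((α_ A.X A.X (X ⊗ B.X)).inv ≫ A.mon.mul ▷ (X ⊗ B.X)) ≫ (α_ A.X X B.X).inv ≫ klExt B ψ =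
        A.X ◁ ((α_ A.X X B.X).inv ≫ klExt B ψ) ≫ (α_ A.X X B.X).inv ≫ klExt B ψ ↔
      (α_ A.X A.X X).hom ≫ A.X ◁ ψ ≫ (α_ A.X X B.X).inv ≫ ψ ▷ B.X ≫ (α_ X B.X B.X).hom ≫
        X ◁ B.mon.mul = A.mon.mul ▷ X ≫ ψ := by
  have h1 : A.X ◁ ((α_ A.X X B.X).inv ≫ klExt B ψ) ≫ (α_ A.X X B.X).inv ≫ klExt B ψ =
      (A.X ◁ (α_ A.X X B.X).inv ≫ (α_ A.X (A.X ⊗ X) B.X).inv) ≫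
        klExt B ((A.X ◁ ψ ≫ (α_ A.X X B.X).inv) ≫ klExt B ψ) := by
    rw [klExt_comp, klExt_whiskerLeft]
    simp
  rw [h1, mul_tensor, Category.assoc, Category.assoc (_ ▷ B.X), Iso.hom_inv_id_assoc, ← klExt_precomp,
    cancel_epi, klExt_injective.eq_iff, Category.assoc, Category.assoc, Iso.inv_comp_eq]
  exact eq_comm

lemma freeAlg_hom (ψ : A.X ⊗ X ⟶ X ⊗ B.X) :
    ((α_ A.X X B.X).inv ≫ klExt B ψ) ▷ B.X ≫ (α_ X B.X B.X).hom ≫ X ◁ B.mon.mul =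
      ((α_ A.X (X ⊗ B.X) B.X).hom ≫ A.X ◁ ((α_ X B.X B.X).hom ≫ X ◁ B.mon.mul)) ≫
        (α_ A.X X B.X).inv ≫ klExt B ψ := by
  rw [comp_whiskerRight, Category.assoc, klExt_klExt]
  simp

/-- The restriction of an action on `X ⊗ B` to `X`. -/
def freeRestrict (z : A.X ⊗ X ⊗ B.X ⟶ X ⊗ B.X) : A.X ⊗ X ⟶ X ⊗ B.X :=
  (ρ_ (A.X ⊗ X)).inv ≫ (A.X ⊗ X) ◁ B.mon.one ≫ (α_ A.X X B.X).hom ≫ z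

/-- Up to the associator, `A ⊗ (X ⊗ B)` is the free algebra on `A ⊗ X`, so an algebra map out of it
is recovered from its restriction. -/
lemma klExt_freeRestrict (z : A.X ⊗ X ⊗ B.X ⟶ X ⊗ B.X)
    (hz : z ▷ B.X ≫ (α_ X B.X B.X).hom ≫ X ◁ B.mon.mul =
      ((α_ A.X (X ⊗ B.X) B.X).hom ≫ A.X ◁ ((α_ X B.X B.X).hom ≫ X ◁ B.mon.mul)) ≫ z) :
    (α_ A.X X B.X).inv ≫ klExt B (freeRestrict z) = z := by
  rw [freeRestrict, klExt_restrict, Iso.inv_hom_id_assoc]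
  rw [comp_whiskerRight, Category.assoc, hz]
  simp

lemma freeRestrict_klExt (ψ : A.X ⊗ X ⟶ X ⊗ B.X) :
    freeRestrict ((α_ A.X X B.X).inv ≫ klExt B ψ) = ψ := by
  rw [freeRestrict, Iso.hom_inv_id_assoc, pure_klExt]

/-- Algebra structures on `X` in the Kleisli category are algebra structures on the free algebra
`X ⊗ B`. -/
def kleisliAlgebraEquivFreeAlgebra (A B : Mon V) (X : V) :
    AlgebraOn (kleisliMonad A B) (Kleisli.mk _ X) ≃ AlgebraOn (emMonad A B) (freeAlg B X) where
  toFun ξ :=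
    { a := { f := (α_ A.X X B.X).inv ≫ klExt B (ξ.a.of : A.X ⊗ X ⟶ X ⊗ B.X)
             h := freeAlg_hom _ }
      unit := Monad.Algebra.Hom.ext
        ((emMonad_freeAlg_unit_iff _).2 ((kleisliMonad_unit_iff _).1 ξ.unit))
      assoc := Monad.Algebra.Hom.ext
        ((emMonad_freeAlg_assoc_iff _).2 ((kleisliMonad_assoc_iff _).1 ξ.assoc)) }
  invFun ζ :=
    { a := klAct (freeRestrict ζ.a.f)
      -- The criteria speak of actions given by an extension; `klExt_freeRestrict` puts the given
      -- action in that form.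
      unit := (kleisliMonad_unit_iff _).2 ((emMonad_freeAlg_unit_iff _).1
        ((congrArg (_ ≫ ·) (klExt_freeRestrict ζ.a.f ζ.a.h)).trans
          (congrArg Monad.Algebra.Hom.f ζ.unit)))
      assoc := (kleisliMonad_assoc_iff _).2 ((emMonad_freeAlg_assoc_iff _).1
        ((congrArg (_ ≫ ·) (klExt_freeRestrict ζ.a.f ζ.a.h)).trans
          ((congrArg Monad.Algebra.Hom.f ζ.assoc).trans
            (congrArg (fun t => A.X ◁ t ≫ t) (klExt_freeRestrict ζ.a.f ζ.a.h)).symm))) }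
  left_inv ξ := AlgebraOn.ext (Kleisli.hom_ext (freeRestrict_klExt (A := A) ξ.a.of))
  right_inv ζ := AlgebraOn.ext (Monad.Algebra.Hom.ext (klExt_freeRestrict ζ.a.f ζ.a.h))

end KleisliAlgebras

/-! ### Actions as monoid morphisms into internal endomorphism monoids -/

section Closed

variable {V : Type u} [Category.{v} V] [MonoidalCategory V] [BraidedCategory V] [MonoidalClosed V]
  {A B : Mon V} {X : V}

lemma kleisliEnd_one_iff (ψ : A.X ⊗ X ⟶ X ⊗ B.X) :
    A.mon.one ≫ lcurry ψ = kleisliId B X ↔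
      (λ_ X).inv ≫ A.mon.one ▷ X ≫ ψ = (ρ_ X).inv ≫ X ◁ B.mon.one := by
  rw [← lcurry.symm.injective.eq_iff, lcurry_symm_eq, lcurry_symm_eq, kleisliId_lev,
    comp_whiskerRight, Category.assoc, lcurry_lev, Iso.inv_comp_eq]

/-- Transposing the product of two copies of `lcurry ψ` gives `ψ` applied twice, followed by the
multiplication of `B`. -/
lemma kleisliEnd_mul_iff (ψ : A.X ⊗ X ⟶ X ⊗ B.X) :
    A.mon.mul ≫ lcurry ψ = (lcurry ψ ⊗ₘ lcurry ψ) ≫ kleisliComp B X X X ↔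
      (α_ A.X A.X X).hom ≫ A.X ◁ ψ ≫ (α_ A.X X B.X).inv ≫ ψ ▷ B.X ≫ (α_ X B.X B.X).hom ≫
        X ◁ B.mon.mul = A.mon.mul ▷ X ≫ ψ := by
  have h : ((lcurry ψ ⊗ₘ lcurry ψ) ≫ kleisliComp B X X X) ▷ X ≫ lev X (X ⊗ B.X) =
      (α_ A.X A.X X).hom ≫ A.X ◁ ψ ≫ (α_ A.X X B.X).inv ≫ ψ ▷ B.X ≫ (α_ X B.X B.X).hom ≫
        X ◁ B.mon.mul := by
    rw [comp_whiskerRight, Category.assoc, kleisliComp_lev, tensorHom_def', comp_whiskerRight,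
      Category.assoc, associator_naturality_left_assoc, ← whisker_exchange_assoc,
      associator_inv_naturality_left_assoc, ← comp_whiskerRight_assoc, lcurry_lev,
      associator_naturality_middle_assoc, ← MonoidalCategory.whiskerLeft_comp_assoc, lcurry_lev]
  rw [← lcurry.symm.injective.eq_iff, lcurry_symm_eq, lcurry_symm_eq, h,
    comp_whiskerRight, Category.assoc, lcurry_lev]
  exact eq_comm

lemma kleisliEnd_one_iff_symm (g : A.X ⟶ lhom X (X ⊗ B.X)) :
    A.mon.one ≫ g = kleisliId B X ↔
      (λ_ X).inv ≫ A.mon.one ▷ X ≫ lcurry.symm g = (ρ_ X).inv ≫ X ◁ B.mon.one := by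
  rw [← kleisliEnd_one_iff, Equiv.apply_symm_apply]

lemma kleisliEnd_mul_iff_symm (g : A.X ⟶ lhom X (X ⊗ B.X)) :
    A.mon.mul ≫ g = (g ⊗ₘ g) ≫ kleisliComp B X X X ↔
      (α_ A.X A.X X).hom ≫ A.X ◁ lcurry.symm g ≫ (α_ A.X X B.X).inv ≫ lcurry.symm g ▷ B.X ≫
        (α_ X B.X B.X).hom ≫ X ◁ B.mon.mul = A.mon.mul ▷ X ≫ lcurry.symm g := by
  rw [← kleisliEnd_mul_iff, Equiv.apply_symm_apply]

/-- Algebra structures in the Kleisli category are monoid morphisms into the endomorphism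
monoid. -/
def kleisliAlgebraEquivHom (A B : Mon V) (X : V) :
    AlgebraOn (kleisliMonad A B) (Kleisli.mk _ X) ≃ (A ⟶ kleisliEnd B X) where
  toFun ξ := Mon.Hom.mk' (M := A) (N := kleisliEnd B X) (lcurry ξ.a.of)
    ((kleisliEnd_one_iff _).2 ((kleisliMonad_unit_iff _).1 ξ.unit))
    ((kleisliEnd_mul_iff _).2 ((kleisliMonad_assoc_iff _).1 ξ.assoc))
  invFun σ :=
    { a := klAct (lcurry.symm (Mon.Hom.hom (M := A) (N := kleisliEnd B X) σ))
      unit := (kleisliMonad_unit_iff _).2 ((kleisliEnd_one_iff_symm _).1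
        (IsMonHom.one_hom (f := σ.hom)))
      assoc := (kleisliMonad_assoc_iff _).2 ((kleisliEnd_mul_iff_symm _).1
        (IsMonHom.mul_hom (f := σ.hom))) }
  left_inv ξ := AlgebraOn.ext (Kleisli.hom_ext (lcurry.symm_apply_apply ξ.a.of))
  right_inv σ := Mon.Hom.ext
    ((lcurry (Z := A.X) (X := X) (Y := X ⊗ B.X)).apply_symm_apply σ.hom)

/-- This is the compatibility of the routes through (c) and (d): extending and then transposing is
transposing and then applying the comparison. -/
lemma lcurry_klExt (ψ : A.X ⊗ X ⟶ X ⊗ B.X) :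
    lcurry ((α_ A.X X B.X).inv ≫ klExt B ψ) =
      lcurry ψ ≫ lwhisker X (X ⊗ B.X) B.X ≫
        (ihom (X ⊗ B.X)).map ((α_ X B.X B.X).hom ≫ X ◁ B.mon.mul) := by
  apply lhom_ext
  rw [lcurry_lev, comp_whiskerRight, comp_whiskerRight, Category.assoc, Category.assoc,
    ihom_map_lev, reassoc_of% @lwhisker_lev, associator_inv_naturality_left_assoc,
    ← comp_whiskerRight_assoc, lcurry_lev, klExt]

section EM

variable (M : EMCat B)

/-- Factoring through the equalizer `V^B(M, M)` amounts to being a morphism of algebras. -/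
lemma emHom_cond_lcurry_iff (z : A.X ⊗ M.A ⟶ M.A) :
    lcurry z ≫ emLeft M M = lcurry z ≫ emRight M M ↔
      z ▷ B.X ≫ emAct M = ((α_ A.X M.A B.X).hom ≫ A.X ◁ emAct M) ≫ z := by
  rw [emHom_cond_iff, lcurry_lev, Iso.inv_comp_eq, Category.assoc]

lemma endo_one_iff (z : A.X ⊗ X ⟶ X) :
    A.mon.one ≫ lcurry z = lid X ↔ ((λ_ X).inv ≫ A.mon.one ▷ X) ≫ z = 𝟙 _ := by
  rw [← lcurry.symm.injective.eq_iff, lcurry_symm_eq, lcurry_symm_eq, lid_lev,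
    comp_whiskerRight, Category.assoc, lcurry_lev, Category.assoc, Iso.inv_comp_eq,
    Category.comp_id]

lemma endo_mul_iff (z : A.X ⊗ X ⟶ X) :
    A.mon.mul ≫ lcurry z = (lcurry z ⊗ₘ lcurry z) ≫ lcomp X X X ↔
      ((α_ A.X A.X X).inv ≫ A.mon.mul ▷ X) ≫ z = A.X ◁ z ≫ z := by
  have h : ((lcurry z ⊗ₘ lcurry z) ≫ lcomp X X X) ▷ X ≫ lev X X =
      (α_ A.X A.X X).hom ≫ A.X ◁ z ≫ z := by
    rw [comp_whiskerRight, Category.assoc, lcomp_lev, tensorHom_def', comp_whiskerRight,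
      Category.assoc, associator_naturality_left_assoc, ← whisker_exchange_assoc, lcurry_lev,
      associator_naturality_middle_assoc, ← MonoidalCategory.whiskerLeft_comp_assoc, lcurry_lev]
  rw [← lcurry.symm.injective.eq_iff, lcurry_symm_eq, lcurry_symm_eq, h,
    comp_whiskerRight, Category.assoc, lcurry_lev, Category.assoc, Iso.inv_comp_eq]

variable [HasEqualizer (emLeft M M) (emRight M M)]

/-- The transpose `A ⟶ V^B(M, M)` of an action of `A` on `M`. -/
def emCurry (a : (emMonad A B).obj M ⟶ M) : A.X ⟶ emHom M M :=
  equalizer.lift (lcurry a.f) ((emHom_cond_lcurry_iff M a.f).2 a.h)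

@[simp]
lemma emCurry_ι (a : (emMonad A B).obj M ⟶ M) : emCurry M a ≫ emι M M = lcurry a.f :=
  equalizer.lift_ι _ _

lemma emEnd_one_iff (k : A.X ⟶ emHom M M) :
    A.mon.one ≫ k = emId M ↔
      ((λ_ M.A).inv ≫ A.mon.one ▷ M.A) ≫ lcurry.symm (k ≫ emι M M) = 𝟙 _ := by
  rw [← endo_one_iff, Equiv.apply_symm_apply, ← cancel_mono (emι M M), Category.assoc, emId_ι]

/-- The inclusion into `[M, M]` is a monomorphism that respects composition, so the law can be
tested in `[M, M]`. -/
lemma emEnd_mul_iff (k : A.X ⟶ emHom M M) :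
    A.mon.mul ≫ k = (k ⊗ₘ k) ≫ emComp M ↔
      ((α_ A.X A.X M.A).inv ≫ A.mon.mul ▷ M.A) ≫ lcurry.symm (k ≫ emι M M) =
        A.X ◁ lcurry.symm (k ≫ emι M M) ≫ lcurry.symm (k ≫ emι M M) := by
  rw [← endo_mul_iff, Equiv.apply_symm_apply, ← cancel_mono (emι M M), Category.assoc,
    Category.assoc, emComp_ι, tensorHom_comp_tensorHom_assoc]

lemma emCurry_symm (a : (emMonad A B).obj M ⟶ M) : lcurry.symm (emCurry M a ≫ emι M M) = a.f := by
  rw [emCurry_ι]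
  exact lcurry.symm_apply_apply _

lemma emHom_uncurry (k : A.X ⟶ emHom M M) :
    lcurry.symm (k ≫ emι M M) ▷ B.X ≫ emAct M =
      ((α_ A.X M.A B.X).hom ≫ A.X ◁ emAct M) ≫ lcurry.symm (k ≫ emι M M) := by
  rw [← emHom_cond_lcurry_iff, Equiv.apply_symm_apply, Category.assoc, Category.assoc]
  exact congrArg (_ ≫ ·) (equalizer.condition _ _)

/-- Algebra structures in the Eilenberg-Moore category are monoid morphisms into the endomorphism
monoid. -/
def emAlgebraEquivHom (A : Mon V) : AlgebraOn (emMonad A B) M ≃ (A ⟶ emEnd M) where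
  toFun ζ := Mon.Hom.mk' (M := A) (N := emEnd M) (emCurry M ζ.a)
    ((emEnd_one_iff M _).2 ((congrArg (_ ≫ ·) (emCurry_symm M ζ.a)).trans
      (congrArg Monad.Algebra.Hom.f ζ.unit)))
    ((emEnd_mul_iff M _).2 ((congrArg (_ ≫ ·) (emCurry_symm M ζ.a)).trans
      ((congrArg Monad.Algebra.Hom.f ζ.assoc).trans
        (congrArg (fun t => A.X ◁ t ≫ t) (emCurry_symm M ζ.a)).symm)))
  invFun σ :=
    { a :=
        { f := lcurry.symm (Mon.Hom.hom (M := A) (N := emEnd M) σ ≫ emι M M)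
          h := emHom_uncurry M _ }
      unit := Monad.Algebra.Hom.ext ((emEnd_one_iff M _).1 (IsMonHom.one_hom (f := σ.hom)))
      assoc := Monad.Algebra.Hom.ext ((emEnd_mul_iff M _).1 (IsMonHom.mul_hom (f := σ.hom))) }
  left_inv ζ := AlgebraOn.ext (Monad.Algebra.Hom.ext (emCurry_symm M ζ.a))
  right_inv _ := Mon.Hom.ext ((cancel_mono (emι M M)).1
    ((emCurry_ι M _).trans (lcurry.apply_symm_apply _)))

end EM

end Closed

/-! ### Coevaluation and transposition along a dual -/

section Dual

variable {V : Type u} [Category.{v} V] [MonoidalCategory V] {X X' X'' W : V} (Y : V)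
  [ExactPairing X' Y]

/-- The morphism `X ⟶ X' ⊗ (Y ⊗ X)` given by the coevaluation of a dual `Y` of `X'`. -/
def coev (X X' Y : V) [ExactPairing X' Y] : X ⟶ X' ⊗ (Y ⊗ X) :=
  tensorLeftHomEquiv X X' Y (Y ⊗ X) (𝟙 _)

lemma tensorLeftHomEquiv_eq (f : Y ⊗ X ⟶ W) :
    tensorLeftHomEquiv X X' Y W f = coev X X' Y ≫ X' ◁ f := by
  rw [coev, ← tensorLeftHomEquiv_naturality, Category.id_comp]

lemma coev_eq : coev X X' Y = (λ_ X).inv ≫ η_ X' Y ▷ X ≫ (α_ X' Y X).hom := by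
  simp [coev, tensorLeftHomEquiv]

lemma coev_naturality (f : X ⟶ X'') : f ≫ coev X'' X' Y = coev X X' Y ≫ X' ◁ Y ◁ f := by
  rw [coev_eq, coev_eq, leftUnitor_inv_naturality_assoc, whisker_exchange_assoc,
    associator_naturality_right, Category.assoc, Category.assoc]

/-- A morphism out of `Y ⊗ X` is determined by its transpose `X ⟶ X' ⊗ W`. -/
lemma coev_ext {f g : Y ⊗ X ⟶ W} (h : coev X X' Y ≫ X' ◁ f = coev X X' Y ≫ X' ◁ g) : f = g := by
  rw [← tensorLeftHomEquiv_eq, ← tensorLeftHomEquiv_eq] at h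
  exact (tensorLeftHomEquiv _ _ _ _).injective h

lemma coev_tensor : coev (X ⊗ W) X' Y = coev X X' Y ▷ W ≫ (α_ X' (Y ⊗ X) W).hom ≫
    X' ◁ (α_ Y X W).hom := by
  simp [coev_eq]

lemma coev_counit : coev X' X' Y ≫ X' ◁ ε_ X' Y = (ρ_ X').inv := by
  simp [coev_eq]

/-- One triangle identity, in the form of the left counit law of `Y ⊗ X`. -/
lemma whiskerLeft_coev :
    Y ◁ coev X X' Y ≫ (α_ Y X' (Y ⊗ X)).inv ≫ ε_ X' Y ▷ (Y ⊗ X) = (λ_ (Y ⊗ X)).inv := by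
  have h := (tensorLeftHomEquiv X X' Y (Y ⊗ X)).symm_apply_apply (𝟙 _)
  change Y ◁ coev X X' Y ≫ (α_ Y X' (Y ⊗ X)).inv ≫ ε_ X' Y ▷ (Y ⊗ X) ≫ (λ_ _).hom = 𝟙 _ at h
  rw [← cancel_mono (λ_ (Y ⊗ X)).hom]
  simpa using h

/-- Naturality of the coevaluation, applied to the coevaluation itself. It gives coassociativity of
`Y ⊗ X` and of its coaction on `X`. -/
lemma coev_coev : coev X X' Y ≫ X' ◁ Y ◁ coev X X' Y ≫ X' ◁ (α_ Y X' (Y ⊗ X)).inv =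
    coev X X' Y ≫ coev X' X' Y ▷ (Y ⊗ X) ≫ (α_ X' (Y ⊗ X') (Y ⊗ X)).hom := by
  rw [← reassoc_of% coev_naturality, coev_tensor]
  simp [← MonoidalCategory.whiskerLeft_comp]

end Dual

/-! ### The comonoid `Y ⊗ X` and its coaction on `X` -/

section DualComon

variable {V : Type u} [Category.{v} V] [MonoidalCategory V] (X Y : V) [ExactPairing X Y]

/-- The comultiplication of `Y ⊗ X` given by the coevaluation. -/
def dualComul : Y ⊗ X ⟶ (Y ⊗ X) ⊗ (Y ⊗ X) := Y ◁ coev X X Y ≫ (α_ Y X (Y ⊗ X)).inv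

/-- The comonoid `Y ⊗ X` for a dual `Y` of `X`. -/
def dualComon : Comon V where
  X := Y ⊗ X
  comon :=
    { counit := ε_ X Y
      comul := dualComul X Y
      counit_comul := by
        rw [dualComul, Category.assoc, whiskerLeft_coev]
      comul_counit := by
        rw [dualComul, Category.assoc, ← associator_inv_naturality_right,
          ← MonoidalCategory.whiskerLeft_comp_assoc, coev_counit]
        simp
      comul_assoc := by
        have h := congrArg (Y ◁ ·) (coev_coev (X := X) (X' := X) Y)
        simp only [MonoidalCategory.whiskerLeft_comp] at h
        have h' := congrArg (fun t => t ≫ (α_ Y X _).inv) h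
        simp only [Category.assoc] at h'
        simp only [dualComul, tensor_whiskerLeft, MonoidalCategory.whiskerLeft_comp, comp_whiskerRight,
          Category.assoc, Iso.inv_hom_id_assoc]
        rw [h']
        monoidal }

lemma coev_dualComul : coev X X Y ≫ coev X X Y ▷ (Y ⊗ X) ≫ (α_ X (Y ⊗ X) (Y ⊗ X)).hom =
    coev X X Y ≫ X ◁ dualComul X Y := by
  rw [← coev_coev, dualComul, MonoidalCategory.whiskerLeft_comp]

/-- The comodule `X` over `Y ⊗ X`. -/
def dualComod : ComodOn (dualComon X Y) X where
  coact := coev X X Y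
  coact_counit := coev_counit Y
  coact_coact := coev_dualComul X Y

end DualComon

/-! ### Turning morphisms out of `Z ⊗ C` into twists along a coaction -/

section Slide

variable {V : Type u} [Category.{v} V] [MonoidalCategory V] [BraidedCategory V]

/-- Apply `r : X ⟶ X' ⊗ C`, move `Z` past `X'`, then apply `m : Z ⊗ C ⟶ W`. -/
def slide {X X' C Z W : V} (r : X ⟶ X' ⊗ C) (m : Z ⊗ C ⟶ W) : Z ⊗ X ⟶ X' ⊗ W :=
  Z ◁ r ≫ (α_ Z X' C).inv ≫ (β_ X' Z).inv ▷ C ≫ (α_ X' Z C).hom ≫ X' ◁ m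

variable {X X' X'' C D Z Z' W W' : V}

lemma slide_comp (r : X ⟶ X' ⊗ C) (m : Z ⊗ C ⟶ W) (g : W ⟶ W') :
    slide r (m ≫ g) = slide r m ≫ X' ◁ g := by
  simp [slide]

/-- Restricting a measuring along `h` has the same effect as pushing the coaction forward along `h`.
-/
lemma slide_whiskerLeft (r : X ⟶ X' ⊗ C) (h : C ⟶ D) (m : Z ⊗ D ⟶ W) :
    slide r (Z ◁ h ≫ m) = slide (r ≫ X' ◁ h) m := by
  simp only [slide, MonoidalCategory.whiskerLeft_comp, Category.assoc]
  rw [associator_inv_naturality_right_assoc, whisker_exchange_assoc,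
    associator_naturality_right_assoc]

lemma slide_whiskerRight (r : X ⟶ X' ⊗ C) (z : Z' ⟶ Z) (m : Z ⊗ C ⟶ W) :
    slide r (z ▷ C ≫ m) = z ▷ X ≫ slide r m := by
  simp only [slide, MonoidalCategory.whiskerLeft_comp]
  rw [← whisker_exchange_assoc, associator_inv_naturality_left_assoc, ← comp_whiskerRight_assoc,
    BraidedCategory.braiding_inv_naturality_left, comp_whiskerRight_assoc,
    associator_naturality_middle_assoc]

lemma slide_precomp (f : X ⟶ X') (r : X' ⟶ X'' ⊗ C) (m : Z ⊗ C ⟶ W) :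
    slide (f ≫ r) m = Z ◁ f ≫ slide r m := by
  simp [slide]

lemma slide_postcomp (r : X ⟶ X' ⊗ C) (f : X' ⟶ X'') (m : Z ⊗ C ⟶ W) :
    slide (r ≫ f ▷ C) m = slide r m ≫ f ▷ W := by
  simp only [slide, MonoidalCategory.whiskerLeft_comp, Category.assoc]
  rw [associator_inv_naturality_middle_assoc, ← comp_whiskerRight_assoc,
    BraidedCategory.braiding_inv_naturality_right, comp_whiskerRight_assoc,
    associator_naturality_left_assoc, whisker_exchange]

lemma slide_unit {E : V} (r : X ⟶ X ⊗ C) (ε : C ⟶ 𝟙_ V) (hr : r ≫ X ◁ ε = (ρ_ X).inv)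
    (η : 𝟙_ V ⟶ E) :
    slide r (𝟙_ V ◁ ε ≫ (λ_ (𝟙_ V)).hom ≫ η) = (λ_ X).hom ≫ (ρ_ X).inv ≫ X ◁ η := by
  rw [slide_whiskerLeft, hr, slide_comp, slide, braiding_inv_tensorUnit_right]
  monoidal

/-- The convolution square of `m` slides to the composite of two slides of `m`. Coassociativity of
`r` replaces `d` by a second coaction; the inverse braiding in `tensorδ` then combines with the one
in `slide` by the hexagon. -/
lemma slide_conv {A B : V} (r : X ⟶ X ⊗ C) (d : C ⟶ C ⊗ C)
    (hr : r ≫ r ▷ C ≫ (α_ X C C).hom = r ≫ X ◁ d) (m : A ⊗ C ⟶ B) :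
    slide r ((A ⊗ A) ◁ d ≫ tensorδ A C A C ≫ (m ⊗ₘ m)) =
      (α_ A A X).hom ≫ A ◁ slide r m ≫ (α_ A X B).inv ≫ slide r m ▷ B ≫ (α_ X B B).hom := by
  -- Moving `A` past `X` and then coacting is coacting first and then moving `A` past `X` and `C` in
  -- turn.
  have nat : (β_ X A).inv ≫ r ▷ A = A ◁ r ⊗≫ (β_ X A).inv ▷ C ⊗≫ X ◁ (β_ C A).inv ⊗≫ 𝟙 _ := by
    rw [← BraidedCategory.braiding_inv_naturality_right, BraidedCategory.braiding_tensor_left_inv]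
    monoidal
  rw [slide_whiskerLeft, ← hr]
  simp only [slide, tensorδ, BraidedCategory.braiding_tensor_right_inv,
    MonoidalCategory.tensorHom_def']
  calc
    _ = 𝟙 _ ⊗≫ A ◁ A ◁ r ⊗≫ A ◁ A ◁ r ▷ C ⊗≫ A ◁ (β_ X A).inv ▷ C ▷ C ⊗≫
        ((β_ X A).inv ▷ (A ⊗ C) ≫ (X ⊗ A) ◁ (β_ C A).inv) ▷ C ⊗≫
        X ◁ ((A ⊗ C) ◁ m ≫ m ▷ B) ⊗≫ 𝟙 _ := by
      monoidal
    _ = 𝟙 _ ⊗≫ A ◁ A ◁ r ⊗≫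
        A ◁ (A ◁ r ⊗≫ (β_ X A).inv ▷ C ⊗≫ X ◁ (β_ C A).inv ⊗≫ 𝟙 ((X ⊗ C) ⊗ A)) ▷ C ⊗≫
        ((β_ X A).inv ▷ (C ⊗ A ⊗ C) ≫ (X ⊗ A) ◁ (C ◁ m)) ⊗≫ X ◁ m ▷ B ⊗≫ 𝟙 _ := by
      rw [← whisker_exchange (β_ X A).inv]
      monoidal
    _ = 𝟙 _ ⊗≫ A ◁ A ◁ r ⊗≫ A ◁ (β_ X A).inv ▷ C ⊗≫
        A ◁ (r ▷ (A ⊗ C) ≫ (X ⊗ C) ◁ m) ⊗≫ (β_ X A).inv ▷ C ▷ B ⊗≫ X ◁ m ▷ B ⊗≫ 𝟙 _ := by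
      rw [← nat, ← whisker_exchange]
      monoidal
    _ = _ := by
      rw [← whisker_exchange]
      monoidal

section SlideDual

variable (Y : V) [ExactPairing X' Y]

/-- Moving `Z` past `X'` on one side of the coevaluation amounts to moving it past `Y` on the other.
Hence sliding along `coev` is a composite of bijections. -/
lemma slide_coev (m : Z ⊗ (Y ⊗ X) ⟶ W) :
    slide (coev X X' Y) m = tensorLeftHomEquiv (Z ⊗ X) X' Y W
      ((α_ Y Z X).inv ≫ (β_ Y Z).hom ▷ X ≫ (α_ Z Y X).hom ≫ m) := by
  -- Naturality of the inverse braiding at `η_ X' Y`, with the hexagon; the crossing with `Y` is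
  -- then undone.
  have h : (λ_ Z).inv ≫ η_ X' Y ▷ Z ≫ (α_ X' Y Z).hom ≫ X' ◁ (β_ Y Z).hom =
      (ρ_ Z).inv ≫ Z ◁ η_ X' Y ≫ (α_ Z X' Y).inv ≫ (β_ X' Z).inv ▷ Y ≫ (α_ X' Z Y).hom := by
    have e := BraidedCategory.braiding_inv_naturality_right Z (η_ X' Y)
    rw [BraidedCategory.braiding_tensor_left_inv, braiding_inv_tensorUnit_left] at e
    have e' := congrArg (fun t => (ρ_ Z).inv ≫ t ≫ (α_ X' Y Z).hom ≫ X' ◁ (β_ Y Z).hom) e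
    simpa [← MonoidalCategory.whiskerLeft_comp] using e'.symm
  rw [tensorLeftHomEquiv_eq, coev_eq, coev_eq, slide]
  calc
    _ = 𝟙 _ ⊗≫ ((ρ_ Z).inv ≫ Z ◁ η_ X' Y ≫ (α_ Z X' Y).inv ≫ (β_ X' Z).inv ▷ Y ≫
        (α_ X' Z Y).hom) ▷ X ⊗≫ X' ◁ m := by monoidal
    _ = _ := by
      rw [← h]
      monoidal

lemma slide_coev_injective :
    Function.Injective (slide (coev X X' Y) : (Z ⊗ (Y ⊗ X) ⟶ W) → (Z ⊗ X ⟶ X' ⊗ W)) := by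
  intro m m' h
  rw [slide_coev, slide_coev] at h
  simpa only [cancel_epi] using (tensorLeftHomEquiv _ _ _ _).injective h

lemma slide_coev_surjective :
    Function.Surjective (slide (coev X X' Y) : (Z ⊗ (Y ⊗ X) ⟶ W) → (Z ⊗ X ⟶ X' ⊗ W)) := by
  intro ψ
  refine ⟨(α_ Z Y X).inv ≫ (β_ Y Z).inv ▷ X ≫ (α_ Y Z X).hom ≫
    (tensorLeftHomEquiv _ _ _ _).symm ψ, ?_⟩
  rw [slide_coev, ← Equiv.eq_symm_apply]
  simp

end SlideDual

end Slide

/-! ### Measurings and the twists they induce -/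

section Measuring

variable {V : Type u} [Category.{v} V] [MonoidalCategory V] [BraidedCategory V] {A B : Mon V}

/-- `m : A ⊗ C ⟶ B` is a measuring. -/
structure IsMeasuring (A B : Mon V) (C : Comon V) (m : A.X ⊗ C.X ⟶ B.X) : Prop where
  one : A.mon.one ▷ C.X ≫ m = 𝟙_ V ◁ C.comon.counit ≫ (λ_ (𝟙_ V)).hom ≫ B.mon.one
  mul : A.mon.mul ▷ C.X ≫ m =
    (A.X ⊗ A.X) ◁ C.comon.comul ≫ tensorδ A.X C.X A.X C.X ≫ (m ⊗ₘ m) ≫ B.mon.mul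

lemma conv_naturality {C D : Comon V} (f : C ⟶ D) (m : A.X ⊗ D.X ⟶ B.X) :
    (A.X ⊗ A.X) ◁ f.hom ≫ (A.X ⊗ A.X) ◁ D.comon.comul ≫ tensorδ A.X D.X A.X D.X ≫ (m ⊗ₘ m) =
      (A.X ⊗ A.X) ◁ C.comon.comul ≫ tensorδ A.X C.X A.X C.X ≫
        (A.X ◁ f.hom ≫ m ⊗ₘ A.X ◁ f.hom ≫ m) := by
  have e := tensorδ_natural (𝟙 A.X) f.hom (𝟙 A.X) f.hom
  rw [id_tensorHom_id, id_tensorHom, id_tensorHom] at e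
  rw [← MonoidalCategory.whiskerLeft_comp_assoc, IsComonHom.hom_comul,
    MonoidalCategory.whiskerLeft_comp, Category.assoc, reassoc_of% e, tensorHom_comp_tensorHom]

/-- Measurings can be detected along comonoid morphisms that are jointly epimorphic after
tensoring. -/
lemma IsMeasuring.of_jointly_epi {C C' D : Comon V} (i : C ⟶ D) (j : C' ⟶ D)
    (hij : ∀ {Z T : V} {a b : Z ⊗ D.X ⟶ T}, Z ◁ i.hom ≫ a = Z ◁ i.hom ≫ b →
      Z ◁ j.hom ≫ a = Z ◁ j.hom ≫ b → a = b) {n : A.X ⊗ D.X ⟶ B.X}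
    (hi : IsMeasuring A B C (A.X ◁ i.hom ≫ n)) (hj : IsMeasuring A B C' (A.X ◁ j.hom ≫ n)) :
    IsMeasuring A B D n where
  one := by
    apply hij
    · rw [whisker_exchange_assoc, hi.one, ← MonoidalCategory.whiskerLeft_comp_assoc,
        IsComonHom.hom_counit]
    · rw [whisker_exchange_assoc, hj.one, ← MonoidalCategory.whiskerLeft_comp_assoc,
        IsComonHom.hom_counit]
  mul := by
    have h1 := conv_naturality i n
    have h2 := conv_naturality j n
    apply hij
    · rw [reassoc_of% h1, whisker_exchange_assoc, hi.mul]
    · rw [reassoc_of% h2, whisker_exchange_assoc, hj.mul]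

variable {X : V} {C : Comon V}

lemma slide_coact_mul (c : ComodOn C X) (m : A.X ⊗ C.X ⟶ B.X) :
    slide c.coact ((A.X ⊗ A.X) ◁ C.comon.comul ≫ tensorδ A.X C.X A.X C.X ≫ (m ⊗ₘ m) ≫
        B.mon.mul) =
      (α_ A.X A.X X).hom ≫ A.X ◁ slide c.coact m ≫ (α_ A.X X B.X).inv ≫
        slide c.coact m ▷ B.X ≫ (α_ X B.X B.X).hom ≫ X ◁ B.mon.mul := by
  have h := congrArg (· ≫ X ◁ B.mon.mul) (slide_conv c.coact C.comon.comul c.coact_coact m)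
  simpa only [← slide_comp, Category.assoc] using h

lemma slide_coact_one (c : ComodOn C X) :
    slide c.coact (𝟙_ V ◁ C.comon.counit ≫ (λ_ (𝟙_ V)).hom ≫ B.mon.one) =
      (λ_ X).hom ≫ (ρ_ X).inv ≫ X ◁ B.mon.one :=
  slide_unit c.coact C.comon.counit c.coact_counit B.mon.one

/-- A measuring turns comodules into objects of `^A V_B`. -/
def IsMeasuring.twistOn {m : A.X ⊗ C.X ⟶ B.X} (hm : IsMeasuring A B C m) (c : ComodOn C X) :
    TwistOn A B X where
  ψ := slide c.coact m
  ψ_mul := by rw [← slide_coact_mul, ← hm.mul, slide_whiskerRight]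
  ψ_one := by rw [← slide_whiskerRight, hm.one, slide_coact_one, Iso.inv_hom_id_assoc]

/-- Since sliding along `coev` is injective, the measuring axioms may be checked after sliding,
where they are the twist axioms of `s`. -/
lemma isMeasuring_dualComon (Y : V) [ExactPairing X Y] (s : TwistOn A B X)
    (m : A.X ⊗ (Y ⊗ X) ⟶ B.X) (hm : slide (coev X X Y) m = s.ψ) :
    IsMeasuring A B (dualComon X Y) m where
  one := by
    apply slide_coev_injective (X := X) (X' := X) Y
    refine Eq.trans ?_ (slide_coact_one (dualComod X Y)).symm
    rw [← s.ψ_one, Iso.hom_inv_id_assoc, ← hm]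
    exact slide_whiskerRight _ _ _
  mul := by
    apply slide_coev_injective (X := X) (X' := X) Y
    refine Eq.trans ?_ (slide_coact_mul (dualComod X Y) m).symm
    have h := s.ψ_mul
    rw [← hm] at h
    exact (slide_whiskerRight _ _ _).trans h.symm

end Measuring

/-! ### The universal property of `P(A, B)` in terms of measurings -/

section Universal

variable {V : Type u} [Category.{v} V] [MonoidalCategory V] [BraidedCategory V] [MonoidalClosed V]
  {A B : Mon V}

lemma isMeasuring_iff {C : Comon V} (m : A.X ⊗ C.X ⟶ B.X) :
    IsMeasuring A B C m ↔ A.mon.one ≫ lcurry m = convOne C B ∧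
      A.mon.mul ≫ lcurry m = (lcurry m ⊗ₘ lcurry m) ≫ convMul C B := by
  rw [← lcurry.symm.injective.eq_iff, lcurry_symm_eq, lcurry_symm_eq, convOne_lev,
    ← lcurry.symm.injective.eq_iff (b := _ ≫ convMul C B), lcurry_symm_eq, lcurry_symm_eq,
    convMul_gen, comp_whiskerRight, comp_whiskerRight, Category.assoc, Category.assoc, lcurry_lev]
  exact ⟨fun h => ⟨h.one, h.mul⟩, fun h => ⟨h.1, h.2⟩⟩

variable {P : Comon V} (hP : UniversalMeasuring A B P)

/-- The monoid morphism `A ⟶ [C, B]` that corresponds to a comonoid morphism `C ⟶ P(A, B)`. -/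
def measuringHom {C : Comon V} (f : C ⟶ P) : A ⟶ convMon C B := hP.homEquiv f

lemma lcurry_universalMeasuring :
    lcurry (universalMeasuring hP) = (measuringHom hP (𝟙 P)).hom :=
  (lcurry (Z := A.X) (X := P.X) (Y := B.X)).apply_symm_apply _

/-- The Yoneda argument: naturality of the bijection at `f`, evaluated at the identity of `P`. -/
lemma measuringHom_eq {C : Comon V} (f : C ⟶ P) :
    (measuringHom hP f).hom = lcurry (A.X ◁ f.hom ≫ universalMeasuring hP) := by
  have h : (measuringHom hP f).hom = lcurry (universalMeasuring hP) ≫ lpre f.hom B.X := by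
    rw [lcurry_universalMeasuring]
    exact congrArg (Mon.Hom.hom (M := A) (N := convMon C B)) (hP.homEquiv_eq f)
  rw [h]
  apply lhom_ext
  rw [lcurry_lev, comp_whiskerRight, Category.assoc, lpre_lev, ← whisker_exchange_assoc,
    lcurry_lev]

lemma isMeasuring_comp {C : Comon V} (f : C ⟶ P) :
    IsMeasuring A B C (A.X ◁ f.hom ≫ universalMeasuring hP) := by
  rw [isMeasuring_iff, ← measuringHom_eq]
  exact ⟨IsMonHom.one_hom (f := (measuringHom hP f).hom),
    IsMonHom.mul_hom (f := (measuringHom hP f).hom)⟩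

lemma isMeasuring_universalMeasuring : IsMeasuring A B P (universalMeasuring hP) := by
  simpa using isMeasuring_comp hP (𝟙 P)

lemma exists_comon_hom {C : Comon V} {m : A.X ⊗ C.X ⟶ B.X} (hm : IsMeasuring A B C m) :
    ∃ f : C ⟶ P, A.X ◁ f.hom ≫ universalMeasuring hP = m := by
  have h := (isMeasuring_iff m).1 hm
  let σ : A ⟶ convMon C B := Mon.Hom.mk' (M := A) (N := convMon C B) (lcurry m) h.1 h.2
  refine ⟨hP.homEquiv.symm σ, lcurry.injective ?_⟩
  rw [← measuringHom_eq]
  exact congrArg (Mon.Hom.hom (M := A) (N := convMon C B)) (hP.homEquiv.apply_symm_apply σ)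

lemma comon_hom_ext {C : Comon V} {f g : C ⟶ P}
    (h : A.X ◁ f.hom ≫ universalMeasuring hP = A.X ◁ g.hom ≫ universalMeasuring hP) : f = g := by
  apply hP.homEquiv.injective
  apply Mon.Hom.ext (M := A) (N := convMon C B)
  exact (measuringHom_eq hP f).trans ((congrArg _ h).trans (measuringHom_eq hP g).symm)

/-- The object of `^A V_B` defined by a comodule over the universal measuring comonoid. -/
def twistOfComod {X : V} (c : ComodOn P X) : TwistOn A B X :=
  (isMeasuring_universalMeasuring hP).twistOn c

end Universal

/-! ### Pushouts of comonoids over a bare object -/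

section PushoutComon

variable {V : Type u} [Category.{v} V] [MonoidalCategory V] {C C' : Comon V} {W Q : V}

section

variable (i : C.X ⟶ Q) {q : Q ⟶ 𝟙_ V} {d : Q ⟶ Q ⊗ Q} (hq : i ≫ q = C.comon.counit)
  (hd : i ≫ d = C.comon.comul ≫ (i ⊗ₘ i))

-- No comonoid law is assumed for `Q`: those of `C` force the laws of `Q` after precomposition with
-- `i`. For a pushout, the two coprojections together then give the laws outright.
include hq hd in
lemma image_counit_comul : i ≫ d ≫ q ▷ Q = i ≫ (λ_ Q).inv := by
  have h := C.comon.counit_comul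
  rw [reassoc_of% hd, MonoidalCategory.tensorHom_def, Category.assoc, whisker_exchange,
    ← comp_whiskerRight_assoc, hq, reassoc_of% h, leftUnitor_inv_naturality]

include hq hd in
lemma image_comul_counit : i ≫ d ≫ Q ◁ q = i ≫ (ρ_ Q).inv := by
  have h := C.comon.comul_counit
  rw [reassoc_of% hd, MonoidalCategory.tensorHom_def', Category.assoc, ← whisker_exchange,
    ← MonoidalCategory.whiskerLeft_comp_assoc, hq, reassoc_of% h, rightUnitor_inv_naturality]

include hd in
lemma image_comul_assoc : i ≫ d ≫ Q ◁ d = i ≫ d ≫ d ▷ Q ≫ (α_ Q Q Q).hom := by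
  have h := C.comon.comul_assoc
  have h1 : (i ⊗ₘ i) ≫ Q ◁ d = C.X ◁ C.comon.comul ≫ (i ⊗ₘ (i ⊗ₘ i)) := by
    rw [← id_tensorHom, ← id_tensorHom, tensorHom_comp_tensorHom, tensorHom_comp_tensorHom, hd,
      Category.id_comp, Category.comp_id]
  have h2 : (i ⊗ₘ i) ≫ d ▷ Q = C.comon.comul ▷ C.X ≫ ((i ⊗ₘ i) ⊗ₘ i) := by
    rw [← tensorHom_id, ← tensorHom_id, tensorHom_comp_tensorHom, tensorHom_comp_tensorHom, hd,
      Category.id_comp, Category.comp_id]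
  rw [reassoc_of% hd, reassoc_of% hd, h1, reassoc_of% h2, reassoc_of% h, associator_naturality]

end

variable (u : W ⟶ C.X) (v : W ⟶ C'.X) [HasPushout u v]
  (hε : u ≫ C.comon.counit = v ≫ C'.comon.counit)
  (hΔ : u ≫ C.comon.comul ≫ (pushout.inl u v ⊗ₘ pushout.inl u v) =
    v ≫ C'.comon.comul ≫ (pushout.inr u v ⊗ₘ pushout.inr u v))

/-- The comonoid structure on a pushout of comonoids over an object. -/
def pushoutComon : Comon V where
  X := pushout u v
  comon :=
    have hl := pushout.inl_desc C.comon.counit C'.comon.counit hε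
    have hr := pushout.inr_desc C.comon.counit C'.comon.counit hε
    have kl := pushout.inl_desc _ _ hΔ
    have kr := pushout.inr_desc _ _ hΔ
    { counit := pushout.desc C.comon.counit C'.comon.counit hε
      comul := pushout.desc _ _ hΔ
      counit_comul := pushout.hom_ext (image_counit_comul _ hl kl) (image_counit_comul _ hr kr)
      comul_counit := pushout.hom_ext (image_comul_counit _ hl kl) (image_comul_counit _ hr kr)
      comul_assoc := pushout.hom_ext (image_comul_assoc _ kl) (image_comul_assoc _ kr) }

/-- The first coprojection as a morphism of comonoids. -/
def pushoutComonInl : C ⟶ pushoutComon u v hε hΔ :=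
  Comon.Hom.mk' (M := C) (N := pushoutComon u v hε hΔ) (pushout.inl u v)
    (pushout.inl_desc _ _ _) (pushout.inl_desc _ _ _)

/-- The second coprojection as a morphism of comonoids. -/
def pushoutComonInr : C' ⟶ pushoutComon u v hε hΔ :=
  Comon.Hom.mk' (M := C') (N := pushoutComon u v hε hΔ) (pushout.inr u v)
    (pushout.inr_desc _ _ _) (pushout.inr_desc _ _ _)

section Closed

variable [MonoidalClosed V] {Z T : V}

/-- Closedness makes `Z ⊗ -` a left adjoint, so it preserves the pushout; currying makes this
explicit. -/
lemma whiskerLeft_pushoutComon_ext {a b : Z ⊗ (pushoutComon u v hε hΔ).X ⟶ T}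
    (hl : Z ◁ (pushoutComonInl u v hε hΔ).hom ≫ a = Z ◁ (pushoutComonInl u v hε hΔ).hom ≫ b)
    (hr : Z ◁ (pushoutComonInr u v hε hΔ).hom ≫ a = Z ◁ (pushoutComonInr u v hε hΔ).hom ≫ b) :
    a = b := by
  apply MonoidalClosed.curry_injective
  refine pushout.hom_ext (f := u) (g := v) ?_ ?_
  · refine (MonoidalClosed.curry_natural_left _ _).symm.trans ?_
    exact (congrArg MonoidalClosed.curry hl).trans (MonoidalClosed.curry_natural_left _ _)
  · refine (MonoidalClosed.curry_natural_left _ _).symm.trans ?_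
    exact (congrArg MonoidalClosed.curry hr).trans (MonoidalClosed.curry_natural_left _ _)

lemma exists_pushoutComon_desc (a : Z ⊗ C.X ⟶ T) (b : Z ⊗ C'.X ⟶ T)
    (h : Z ◁ u ≫ a = Z ◁ v ≫ b) : ∃ c : Z ⊗ (pushoutComon u v hε hΔ).X ⟶ T,
      Z ◁ (pushoutComonInl u v hε hΔ).hom ≫ c = a ∧
        Z ◁ (pushoutComonInr u v hε hΔ).hom ≫ c = b := by
  have h' : u ≫ MonoidalClosed.curry a = v ≫ MonoidalClosed.curry b := by
    rw [← MonoidalClosed.curry_natural_left, h, MonoidalClosed.curry_natural_left]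
  refine ⟨MonoidalClosed.uncurry (pushout.desc _ _ h'), ?_, ?_⟩
  · refine (MonoidalClosed.uncurry_natural_left _ _).symm.trans ?_
    exact (congrArg _ (pushout.inl_desc _ _ h')).trans (MonoidalClosed.uncurry_curry _)
  · refine (MonoidalClosed.uncurry_natural_left _ _).symm.trans ?_
    exact (congrArg _ (pushout.inr_desc _ _ h')).trans (MonoidalClosed.uncurry_curry _)

end Closed

end PushoutComon

/-! ### Comodules and comodule morphisms as transposes -/

section Transpose

variable {V : Type u} [Category.{v} V] [MonoidalCategory V] {X X' Y Y' Q W : V}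
  [ExactPairing X Y] [ExactPairing X' Y']

lemma coev_comul_map (i : Y ⊗ X ⟶ Q) :
    coev X X Y ≫ X ◁ (dualComul X Y ≫ (i ⊗ₘ i)) =
      (coev X X Y ≫ X ◁ i) ≫ (coev X X Y ≫ X ◁ i) ▷ Q ≫ (α_ X Q Q).hom := by
  have h := coev_dualComul X Y
  rw [MonoidalCategory.whiskerLeft_comp, ← reassoc_of% h, MonoidalCategory.tensorHom_def']
  simp [whisker_exchange_assoc]

lemma comp_counit_eq_iff {P : Comon V} (g : Y ⊗ X ⟶ P.X) :
    g ≫ P.comon.counit = ε_ X Y ↔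
      (coev X X Y ≫ X ◁ g) ≫ X ◁ P.comon.counit = (ρ_ X).inv := by
  rw [Category.assoc, ← MonoidalCategory.whiskerLeft_comp, ← coev_counit Y]
  exact ⟨fun e => by rw [e], fun e => coev_ext Y e⟩

/-- Transposing along the dual turns compatibility with comultiplications into coassociativity of
the coaction. -/
lemma comp_comul_eq_iff {P : Comon V} (g : Y ⊗ X ⟶ P.X) :
    g ≫ P.comon.comul = dualComul X Y ≫ (g ⊗ₘ g) ↔
      (coev X X Y ≫ X ◁ g) ≫ (coev X X Y ≫ X ◁ g) ▷ P.X ≫ (α_ X P.X P.X).hom =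
        (coev X X Y ≫ X ◁ g) ≫ X ◁ P.comon.comul := by
  rw [← coev_comul_map, Category.assoc, ← MonoidalCategory.whiskerLeft_comp]
  exact ⟨fun e => by rw [e], fun e => coev_ext Y e.symm⟩

lemma coev_symm {P : V} (r : X ⟶ X ⊗ P) :
    coev X X Y ≫ X ◁ (tensorLeftHomEquiv X X Y P).symm r = r := by
  rw [← tensorLeftHomEquiv_eq, Equiv.apply_symm_apply]

/-- The comonoid morphism `Y ⊗ X ⟶ P` that corresponds to a comodule structure on `X`. -/
def comonHomOfComod {P : Comon V} (Y : V) [ExactPairing X Y] (c : ComodOn P X) :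
    dualComon X Y ⟶ P :=
  Comon.Hom.mk' (M := dualComon X Y) ((tensorLeftHomEquiv X X Y P.X).symm c.coact)
    ((comp_counit_eq_iff _).2 (by rw [coev_symm, c.coact_counit]))
    ((comp_comul_eq_iff _).2 (by rw [coev_symm, c.coact_coact]))

lemma coev_comonHomOfComod {P : Comon V} (Y : V) [ExactPairing X Y] (c : ComodOn P X) :
    coev X X Y ≫ X ◁ (comonHomOfComod Y c).hom = c.coact :=
  coev_symm c.coact

/-- The comodule structure on `X` that corresponds to a comonoid morphism `Y ⊗ X ⟶ P`. -/
def comodOfComonHom {P : Comon V} (Y : V) [ExactPairing X Y] (g : dualComon X Y ⟶ P) :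
    ComodOn P X where
  coact := coev X X Y ≫ X ◁ g.hom
  coact_counit := (comp_counit_eq_iff _).1 (IsComonHom.hom_counit g.hom)
  coact_coact := (comp_comul_eq_iff _).1 (IsComonHom.hom_comul g.hom)

/-- The morphism `Y' ⊗ X ⟶ Y ⊗ X` given by the dual `Y' ⟶ Y` of `f : X ⟶ X'`. -/
def dualWhisker (Y Y' : V) [ExactPairing X Y] [ExactPairing X' Y'] (f : X ⟶ X') :
    Y' ⊗ X ⟶ Y ⊗ X :=
  (tensorLeftHomEquiv X X' Y' (Y ⊗ X)).symm (coev X X Y ≫ f ▷ (Y ⊗ X))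

lemma coev_dualWhisker (f : X ⟶ X') :
    coev X X' Y' ≫ X' ◁ dualWhisker Y Y' f = coev X X Y ≫ f ▷ (Y ⊗ X) := by
  rw [← tensorLeftHomEquiv_eq, dualWhisker, Equiv.apply_symm_apply]

/-- Both composites out of `Y' ⊗ X` are compared by transposing over `Y'`. When `h` and `h'`
represent coactions of `P`, the right side says that `f` is a comodule morphism. -/
lemma dualWhisker_comp_eq_iff (f : X ⟶ X') (h : Y ⊗ X ⟶ W) (h' : Y' ⊗ X' ⟶ W) :
    dualWhisker Y Y' f ≫ h = Y' ◁ f ≫ h' ↔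
      (coev X X Y ≫ X ◁ h) ≫ f ▷ W = f ≫ coev X' X' Y' ≫ X' ◁ h' := by
  have h1 : coev X X' Y' ≫ X' ◁ (dualWhisker Y Y' f ≫ h) = (coev X X Y ≫ X ◁ h) ≫ f ▷ W := by
    rw [MonoidalCategory.whiskerLeft_comp, reassoc_of% coev_dualWhisker, Category.assoc,
      whisker_exchange]
  have h2 : coev X X' Y' ≫ X' ◁ (Y' ◁ f ≫ h') = f ≫ coev X' X' Y' ≫ X' ◁ h' := by
    rw [MonoidalCategory.whiskerLeft_comp, ← reassoc_of% coev_naturality]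
  rw [← h1, ← h2]
  exact ⟨fun e => by rw [e], fun e => coev_ext Y' e⟩

lemma dualWhisker_counit (f : X ⟶ X') :
    dualWhisker Y Y' f ≫ (dualComon X Y).comon.counit =
      Y' ◁ f ≫ (dualComon X' Y').comon.counit := by
  refine (dualWhisker_comp_eq_iff f (ε_ X Y) (ε_ X' Y')).2 ?_
  rw [coev_counit, coev_counit, rightUnitor_inv_naturality]

/-- If `f` intertwines the morphisms `X ⟶ X ⊗ Q` and `X' ⟶ X' ⊗ Q` given by `i` and `j`, it
intertwines their iterates. With `i`, `j` the coprojections, this makes the comultiplication of the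
pushout well defined. -/
lemma dualWhisker_comul (f : X ⟶ X') (i : Y ⊗ X ⟶ Q) (j : Y' ⊗ X' ⟶ Q)
    (hij : dualWhisker Y Y' f ≫ i = Y' ◁ f ≫ j) :
    dualWhisker Y Y' f ≫ (dualComon X Y).comon.comul ≫ (i ⊗ₘ i) =
      Y' ◁ f ≫ (dualComon X' Y').comon.comul ≫ (j ⊗ₘ j) := by
  rw [dualWhisker_comp_eq_iff] at hij
  refine (dualWhisker_comp_eq_iff f (dualComul X Y ≫ (i ⊗ₘ i)) (dualComul X' Y' ≫ (j ⊗ₘ j))).2 ?_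
  rw [coev_comul_map, coev_comul_map]
  generalize coev X X Y ≫ X ◁ i = r at hij
  generalize coev X' X' Y' ≫ X' ◁ j = r' at hij
  rw [Category.assoc, Category.assoc, ← associator_naturality_left, ← comp_whiskerRight_assoc,
    hij, comp_whiskerRight_assoc, reassoc_of% hij]

end Transpose

/-! ### Equality morphisms lie over equality morphisms of carriers -/

section EqToHom

variable {V : Type u} [Category.{v} V] [MonoidalCategory V] {A B : Mon V} {P : Comon V}

lemma eqToHom_hom_hom_comod {M N : DualizableComod P} (h : M = N) :
    (eqToHom h).hom.hom = eqToHom (congrArg (fun M => M.obj.X) h) := by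
  subst h
  rfl

lemma eqToHom_hom_hom_twist {M N : DualizableTwist A B} (h : M = N) :
    (eqToHom h).hom.hom = eqToHom (congrArg (fun M => M.obj.X) h) := by
  subst h
  rfl

end EqToHom

/-! ### The bijection on structures and the isomorphism of categories -/

section Main

variable {V : Type u} [Category.{v} V] [MonoidalCategory V] [BraidedCategory V] [MonoidalClosed V]
  {A B : Mon V} {P : Comon V} (hP : UniversalMeasuring A B P) {X X' : V}

lemma twistOfComod_surjective (hX : IsDualizable X) :
    Function.Surjective (twistOfComod hP : ComodOn P X → TwistOn A B X) := by
  obtain ⟨Y, ⟨_⟩⟩ := hX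
  intro s
  obtain ⟨m, hm⟩ := slide_coev_surjective (X := X) (X' := X) Y s.ψ
  obtain ⟨g, hg⟩ := exists_comon_hom hP (isMeasuring_dualComon Y s m hm)
  refine ⟨comodOfComonHom Y g, TwistOn.ext ?_⟩
  refine Eq.trans ?_ hm
  rw [← hg]
  exact (slide_whiskerLeft (coev X X Y) g.hom (universalMeasuring hP)).symm

/-- Between dualizable comodules, morphisms that are compatible with the twists are morphisms of
comodules. -/
lemma comod_comm_of_twist_comm [HasPushouts V] (hX : IsDualizable X) (hX' : IsDualizable X')
    (c : ComodOn P X) (c' : ComodOn P X') (f : X ⟶ X')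
    (hf : (twistOfComod hP c).ψ ≫ f ▷ B.X = A.X ◁ f ≫ (twistOfComod hP c').ψ) :
    c.coact ≫ f ▷ P.X = f ≫ c'.coact := by
  obtain ⟨Y, ⟨_⟩⟩ := hX
  obtain ⟨Y', ⟨_⟩⟩ := hX'
  -- The span to push out: the transpose of `f` gives one leg, `f` itself the other.
  let u : Y' ⊗ X ⟶ (dualComon X Y).X := dualWhisker Y Y' f
  let v : Y' ⊗ X ⟶ (dualComon X' Y').X := Y' ◁ f
  have hε : u ≫ (dualComon X Y).comon.counit = v ≫ (dualComon X' Y').comon.counit :=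
    dualWhisker_counit f
  have hΔ : u ≫ (dualComon X Y).comon.comul ≫ (pushout.inl u v ⊗ₘ pushout.inl u v) =
      v ≫ (dualComon X' Y').comon.comul ≫ (pushout.inr u v ⊗ₘ pushout.inr u v) :=
    dualWhisker_comul f _ _ pushout.condition
  let g := comonHomOfComod Y c
  let g' := comonHomOfComod Y' c'
  -- Slid along `coev X X' Y'`, the two sides become the two sides of `hf`.
  have hm : A.X ◁ u ≫ A.X ◁ g.hom ≫ universalMeasuring hP =
      A.X ◁ v ≫ A.X ◁ g'.hom ≫ universalMeasuring hP := by
    apply slide_coev_injective (X := X) (X' := X') Y'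
    refine (slide_whiskerLeft _ u _).trans (Eq.trans ?_ (slide_whiskerLeft _ v _).symm)
    refine (congrArg (slide · _) (coev_dualWhisker f)).trans
      (Eq.trans ?_ (congrArg (slide · _) (coev_naturality Y' f)))
    refine (slide_postcomp _ _ _).trans (Eq.trans ?_ (slide_precomp _ _ _).symm)
    have e : slide (coev X X Y) (A.X ◁ g.hom ≫ universalMeasuring hP) = (twistOfComod hP c).ψ :=
      (slide_whiskerLeft _ _ _).trans (congrArg (slide · _) (coev_comonHomOfComod Y c))
    have e' : slide (coev X' X' Y') (A.X ◁ g'.hom ≫ universalMeasuring hP) =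
        (twistOfComod hP c').ψ :=
      (slide_whiskerLeft _ _ _).trans (congrArg (slide · _) (coev_comonHomOfComod Y' c'))
    exact (congrArg (· ≫ _) e).trans (hf.trans (congrArg (_ ≫ ·) e').symm)
  obtain ⟨n, hn, hn'⟩ := exists_pushoutComon_desc u v hε hΔ _ _ hm
  have hmeas : IsMeasuring A B (pushoutComon u v hε hΔ) n :=
    IsMeasuring.of_jointly_epi (pushoutComonInl u v hε hΔ) (pushoutComonInr u v hε hΔ)
      (whiskerLeft_pushoutComon_ext u v hε hΔ) (hn ▸ isMeasuring_comp hP g)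
      (hn' ▸ isMeasuring_comp hP g')
  obtain ⟨k, rfl⟩ := exists_comon_hom hP hmeas
  -- Both are comonoid morphisms into `P` inducing the same measuring, so uniqueness applies.
  have hg : pushoutComonInl u v hε hΔ ≫ k = g := comon_hom_ext hP (by simpa using hn)
  have hg' : pushoutComonInr u v hε hΔ ≫ k = g' := comon_hom_ext hP (by simpa using hn')
  have h : u ≫ g.hom = v ≫ g'.hom := by
    rw [← hg, ← hg']
    exact (pushout.condition_assoc k.hom :)
  have h' := (dualWhisker_comp_eq_iff f g.hom g'.hom).1 h
  exact (congrArg (· ≫ _) (coev_comonHomOfComod Y c)).symm.trans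
    (h'.trans (congrArg (f ≫ ·) (coev_comonHomOfComod Y' c')))

lemma twist_comm_of_comod_comm (c : ComodOn P X) (c' : ComodOn P X') (f : X ⟶ X')
    (hf : c.coact ≫ f ▷ P.X = f ≫ c'.coact) :
    (twistOfComod hP c).ψ ≫ f ▷ B.X = A.X ◁ f ≫ (twistOfComod hP c').ψ :=
  (slide_postcomp _ _ _).symm.trans ((congrArg (slide · _) hf).trans (slide_precomp _ _ _))

/-- If two coactions give the same twist, the identity of `X` respects the twists, hence the
coactions. -/
lemma twistOfComod_injective [HasPushouts V] (hX : IsDualizable X) :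
    Function.Injective (twistOfComod hP : ComodOn P X → TwistOn A B X) := by
  intro c c' h
  have e := comod_comm_of_twist_comm hP hX hX c c' (𝟙 X) (by rw [h]; simp)
  exact ComodOn.ext (by simpa using e)

/-- Comodule structures on a dualizable object are morphisms satisfying the twist axioms. -/
def comodEquivTwist [HasPushouts V] (X : V) (hX : IsDualizable X) :
    ComodOn P X ≃ TwistOn A B X :=
  Equiv.ofBijective (twistOfComod hP)
    ⟨twistOfComod_injective hP hX, twistOfComod_surjective hP hX⟩

variable [HasPushouts V]

/-- The functor from dualizable comodules to dualizable objects of `^A V_B`. -/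
def comodToTwist : DualizableComod P ⥤ DualizableTwist A B where
  obj M := ⟨⟨M.obj.X, comodEquivTwist hP M.obj.X M.property M.obj.str⟩, M.property⟩
  map {M N} f := ObjectProperty.homMk
    { hom := f.hom.hom
      comm := twist_comm_of_comod_comm hP M.obj.str N.obj.str f.hom.hom f.hom.comm }

/-- The functor from dualizable objects of `^A V_B` to dualizable comodules. -/
def twistToComod : DualizableTwist A B ⥤ DualizableComod P where
  obj M := ⟨⟨M.obj.X, (comodEquivTwist hP M.obj.X M.property).symm M.obj.str⟩, M.property⟩
  map {M N} f := ObjectProperty.homMk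
    { hom := f.hom.hom
      comm := comod_comm_of_twist_comm hP M.property N.property _ _ f.hom.hom (by
        have e := (comodEquivTwist hP M.obj.X M.property).apply_symm_apply M.obj.str
        have e' := (comodEquivTwist hP N.obj.X N.property).apply_symm_apply N.obj.str
        refine (congrArg (fun s : TwistOn A B M.obj.X => s.ψ ≫ _) e).trans
          (f.hom.comm.trans (congrArg (fun s : TwistOn A B N.obj.X => _ ≫ s.ψ) e').symm)) }

lemma comodToTwist_comp_twistToComod : comodToTwist hP ⋙ twistToComod hP = 𝟭 _ := by
  have h (M : DualizableComod P) : (comodToTwist hP ⋙ twistToComod hP).obj M = M := by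
    obtain ⟨⟨X, s⟩, hX⟩ := M
    exact congrArg (fun s => (⟨⟨X, s⟩, hX⟩ : DualizableComod P))
      ((comodEquivTwist hP X hX).symm_apply_apply s)
  refine CategoryTheory.Functor.ext h fun M N f => ?_
  apply ObjectProperty.hom_ext
  apply RightComod.Hom.ext
  refine Eq.trans ?_ (congrArg₂ (fun a b => a ≫ f.hom.hom ≫ b) (eqToHom_hom_hom_comod (h M))
    (eqToHom_hom_hom_comod (h N).symm)).symm
  -- The object equality does not change the carrier, so both `eqToHom` reduce to identities.
  exact ((Category.id_comp _).trans (Category.comp_id _)).symm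

lemma twistToComod_comp_comodToTwist : twistToComod hP ⋙ comodToTwist hP = 𝟭 _ := by
  have h (M : DualizableTwist A B) : (twistToComod hP ⋙ comodToTwist hP).obj M = M := by
    obtain ⟨⟨X, s⟩, hX⟩ := M
    exact congrArg (fun s => (⟨⟨X, s⟩, hX⟩ : DualizableTwist A B))
      ((comodEquivTwist hP X hX).apply_symm_apply s)
  refine CategoryTheory.Functor.ext h fun M N f => ?_
  apply ObjectProperty.hom_ext
  apply TwistCat.Hom.ext
  refine Eq.trans ?_ (congrArg₂ (fun a b => a ≫ f.hom.hom ≫ b) (eqToHom_hom_hom_twist (h M))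
    (eqToHom_hom_hom_twist (h N).symm)).symm
  exact ((Category.id_comp _).trans (Category.comp_id _)).symm

end Main

/-! ### Pushouts from local presentability -/

section LocallyPresentable

variable (V : Type u) [Category.{v} V]

lemma hasPushouts_of_isLocallyPresentable [IsLocallyPresentable.{w} V] : HasPushouts V := by
  obtain ⟨κ, _, _⟩ := IsLocallyPresentable.exists_cardinal.{w} V
  have : HasColimitsOfSize.{w, w} V := inferInstance
  have := hasFiniteColimits_of_hasColimitsOfSize V
  infer_instance

end LocallyPresentable

end Sweedler

end

theorem mainTheorem9 {V : Type u} [Category.{v} V] [MonoidalCategory V] [BraidedCategory V]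
    [MonoidalClosed V] [IsLocallyPresentable.{w} V] (A B : Mon V) :
    (∀ X : V,
      ∃ (e₀₁ : Sweedler.TwistOn A B X ≃
            Sweedler.AlgebraOn (Sweedler.kleisliMonad A B) (Kleisli.mk _ X))
        (e₁₂ : Sweedler.AlgebraOn (Sweedler.kleisliMonad A B) (Kleisli.mk _ X) ≃
            (A ⟶ Sweedler.kleisliEnd B X))
        (e₁₃ : Sweedler.AlgebraOn (Sweedler.kleisliMonad A B) (Kleisli.mk _ X) ≃
            Sweedler.AlgebraOn (Sweedler.emMonad A B) (Sweedler.freeAlg B X))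
        (e₃₄ : Sweedler.AlgebraOn (Sweedler.emMonad A B) (Sweedler.freeAlg B X) ≃
            (A ⟶ Sweedler.emEnd (Sweedler.freeAlg B X)))
        (e₂₄ : (A ⟶ Sweedler.kleisliEnd B X) ≃ (A ⟶ Sweedler.emEnd (Sweedler.freeAlg B X))),
        (∀ s, (e₀₁ s).a.of = s.ψ) ∧
        (∀ ξ, (e₁₂ ξ).hom = Sweedler.lcurry ξ.a.of) ∧
        (∀ ξ, (e₁₃ ξ).a.f =
          (α_ A.X X B.X).inv ≫ ξ.a.of ▷ B.X ≫ (α_ X B.X B.X).hom ≫ X ◁ B.mon.mul) ∧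
        (∀ ζ, (e₃₄ ζ).hom ≫ Sweedler.emι (Sweedler.freeAlg B X) (Sweedler.freeAlg B X) =
          Sweedler.lcurry ζ.a.f) ∧
        (∀ σ, (e₂₄ σ).hom ≫ Sweedler.emι (Sweedler.freeAlg B X) (Sweedler.freeAlg B X) =
          σ.hom ≫ Sweedler.lwhisker X (X ⊗ B.X) B.X ≫
            (ihom (X ⊗ B.X)).map ((α_ X B.X B.X).hom ≫ X ◁ B.mon.mul)) ∧
        (∀ ξ, e₂₄ (e₁₂ ξ) = e₃₄ (e₁₃ ξ))) ∧
    ∀ (P : Comon V) (hP : Sweedler.UniversalMeasuring A B P),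
      ∃ e : ∀ X : V, Sweedler.IsDualizable X →
          (Sweedler.ComodOn P X ≃ Sweedler.TwistOn A B X),
        (∀ X hX c, (e X hX c).ψ = Sweedler.twistOfCoact hP c.coact) ∧
        ∃ (F : Sweedler.DualizableComod P ⥤ Sweedler.DualizableTwist A B)
          (G : Sweedler.DualizableTwist A B ⥤ Sweedler.DualizableComod P),
          F ⋙ G = 𝟭 _ ∧ G ⋙ F = 𝟭 _ ∧
          F ⋙ ObjectProperty.ι _ ⋙ Sweedler.TwistCat.forget A B =
            ObjectProperty.ι _ ⋙ Sweedler.RightComod.forget P ∧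
          ∀ M, (F.obj M).obj = ⟨M.obj.X, e M.obj.X M.property M.obj.str⟩ := by
  have := Sweedler.hasPushouts_of_isLocallyPresentable.{w} V
  refine ⟨fun X => ?_, fun P hP => ?_⟩
  · refine ⟨Sweedler.twistEquivKleisliAlgebra A B X, Sweedler.kleisliAlgebraEquivHom A B X,
      Sweedler.kleisliAlgebraEquivFreeAlgebra A B X,
      Sweedler.emAlgebraEquivHom (Sweedler.freeAlg B X) A,
      -- The bijection (c)–(e) is the composite through (b) and (d), so compatibility is automatic;
      -- its formula is what needs `lcurry_klExt`.
      (Sweedler.kleisliAlgebraEquivHom A B X).symm.trans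
        ((Sweedler.kleisliAlgebraEquivFreeAlgebra A B X).trans
          (Sweedler.emAlgebraEquivHom (Sweedler.freeAlg B X) A)),
      fun _ => rfl, fun _ => rfl, fun _ => rfl,
      fun ζ => Sweedler.emCurry_ι (Sweedler.freeAlg B X) ζ.a, fun σ => ?_, fun ξ => ?_⟩
    · obtain ⟨ξ, rfl⟩ := (Sweedler.kleisliAlgebraEquivHom A B X).surjective σ
      rw [Equiv.trans_apply, Equiv.symm_apply_apply]
      exact (Sweedler.emCurry_ι (Sweedler.freeAlg B X) _).trans
        (Sweedler.lcurry_klExt (A := A) ξ.a.of)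
    · rw [Equiv.trans_apply, Equiv.symm_apply_apply, Equiv.trans_apply]
  · exact ⟨Sweedler.comodEquivTwist hP, fun _ _ _ => rfl, Sweedler.comodToTwist hP,
      Sweedler.twistToComod hP, Sweedler.comodToTwist_comp_twistToComod hP,
      Sweedler.twistToComod_comp_comodToTwist hP, rfl, fun _ => rfl⟩
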